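/- Let $\sigma\in\{+1,-1\}$ and let $r=r(x,t)$, $x\in\mathbb R$, $t\ge 0$, be a real function such that $r$ and $r_t$ are continuous on $\mathbb R\times[0,\infty)$ and, for every $T>0$, $|r(x,t)|$ and $|r_t(x,t)|$ are bounded for $0\le t\le T$ by an integrable function of $x$ that tends to $0$ as $|x|\to\infty$. Suppose that, for all $x\in\mathbb R$ and $t\ge0$, $$r_{tx}=2\sigma\, r\int_x^{\infty}(r^2)_t\,dy+r .$$ For fixed $t$ consider the Zakharov–Shabat system $$u_{1x}=-i\mu u_1-\sigma r u_2,\qquad u_{2x}=r u_1+i\mu u_2 ,$$ and its solutions determined by $\Phi\sim\binom10e^{-i\mu x}$ as $x\to-\infty$, $\Psi\sim\binom01e^{i\mu x}$ as $x\to+\infty$ (for $\operatorname{Im}\mu\ge0$) and $\overline\Psi\sim\binom10e^{-i\mu x}$ as $x\to+\infty$ (for real $\mu$). Put $a(\mu,t)=W(\Phi,\Psi)=\Phi_1\Psi_2-\Phi_2\Psi_1$ for $\operatorname{Im}\mu\ge0$, and define $b(\mu,t)$ for real $\mu$ by $\Phi=a\overline\Psi+b\Psi$. The eigenvalues at time $t$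 are the zeros $\mu_j$ of $a(\cdot,t)$ in the open upper half-plane, and the normalization constants $c_j(t)$ are defined by $\Phi(\cdot,\mu_j)=c_j(t)\,\Psi(\cdot,\mu_j)$. Then for every $t\ge0$: 1. $a(\mu,t)=a(\mu,0)$ for all $\mu$ with $\operatorname{Im}\mu\ge0$; 2. $b(\mu,t)=b(\mu,0)\,e^{-\frac{i}{2\mu}t}$ for all real $\mu\ne0$; 3. the set of eigenvalues at time $t$ is the set of eigenvalues at time $0$; 4. $c_j(t)=c_j(0)\,e^{-\frac{i}{2\mu_j}t}$ for every eigenvalue $\mu_j$. -/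

import Mathlib

open Set Filter Topology MeasureTheory

noncomputable section

namespace ZS

/-- `u = (u₁, u₂)` solves, on the whole line, the Zakharov-Shabat system
`u₁' = -iμ u₁ - σ r u₂`, `u₂' = r u₁ + iμ u₂` with real potential `r`. The sign `σ = 1` is the
anti-symmetric case and `σ = -1` the symmetric case. -/
def IsSolution (σ : ℝ) (r : ℝ → ℝ) (μ : ℂ) (u : ℝ → ℂ × ℂ) : Prop :=
  ∀ x : ℝ,
    HasDerivAt (fun y => (u y).1)
      (-Complex.I * μ * (u x).1 - (σ : ℂ) * (r x : ℂ) * (u x).2) x ∧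
    HasDerivAt (fun y => (u y).2)
      ((r x : ℂ) * (u x).1 + Complex.I * μ * (u x).2) x

/-- Solutions with `Φ ~ (1, 0) e^{-iμx}` as `x → -∞`. -/
def IsPhi (σ : ℝ) (r : ℝ → ℝ) (μ : ℂ) (u : ℝ → ℂ × ℂ) : Prop :=
  IsSolution σ r μ u ∧
    Tendsto (fun x : ℝ => Complex.exp (Complex.I * μ * x) • u x) atBot (𝓝 ((1, 0) : ℂ × ℂ))

/-- Solutions with `Ψ ~ (0, 1) e^{iμx}` as `x → +∞`. -/
def IsPsi (σ : ℝ) (r : ℝ → ℝ) (μ : ℂ) (u : ℝ → ℂ × ℂ) : Prop :=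
  IsSolution σ r μ u ∧
    Tendsto (fun x : ℝ => Complex.exp (-Complex.I * μ * x) • u x) atTop (𝓝 ((0, 1) : ℂ × ℂ))

/-- Solutions with `Ψ̄ ~ (1, 0) e^{-iμx}` as `x → +∞`. -/
def IsPsiBar (σ : ℝ) (r : ℝ → ℝ) (μ : ℂ) (u : ℝ → ℂ × ℂ) : Prop :=
  IsSolution σ r μ u ∧
    Tendsto (fun x : ℝ => Complex.exp (Complex.I * μ * x) • u x) atTop (𝓝 ((1, 0) : ℂ × ℂ))

/-- The eigenfunction `Φ(·, μ)`. For an integrable continuous potential it exists and is unique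
when `0 ≤ Im μ`, and it is only used there. -/
def phi (σ : ℝ) (r : ℝ → ℝ) (μ : ℂ) : ℝ → ℂ × ℂ := Classical.epsilon (IsPhi σ r μ)

/-- The eigenfunction `Ψ(·, μ)`. For an integrable continuous potential it exists and is unique
when `0 ≤ Im μ`, and it is only used there. -/
def psi (σ : ℝ) (r : ℝ → ℝ) (μ : ℂ) : ℝ → ℂ × ℂ := Classical.epsilon (IsPsi σ r μ)

/-- The eigenfunction `Ψ̄(·, μ)`. For an integrable continuous potential it exists and is unique
when `Im μ ≤ 0`; it is only used for real `μ`. -/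
def psiBar (σ : ℝ) (r : ℝ → ℝ) (μ : ℂ) : ℝ → ℂ × ℂ := Classical.epsilon (IsPsiBar σ r μ)

/-- The Wronskian `W(u, v) = u₁ v₂ - u₂ v₁`. -/
def wronskian (u v : ℝ → ℂ × ℂ) (x : ℝ) : ℂ := (u x).1 * (v x).2 - (u x).2 * (v x).1

/-- The scattering coefficient `a(μ) = W(Φ, Ψ)`, `0 ≤ Im μ` (the Wronskian of two solutions does
not depend on `x`, so that it may be read off at `x = 0`). -/
def coeffA (σ : ℝ) (r : ℝ → ℝ) (μ : ℂ) : ℂ := wronskian (phi σ r μ) (psi σ r μ) 0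

/-- The scattering coefficient `b(μ)`, `μ` real, defined by `Φ = a(μ) Ψ̄ + b(μ) Ψ`. -/
def coeffB (σ : ℝ) (r : ℝ → ℝ) (μ : ℝ) : ℂ :=
  Classical.epsilon fun b : ℂ =>
    ∀ x : ℝ, phi σ r μ x = coeffA σ r μ • psiBar σ r μ x + b • psi σ r μ x

/-- The eigenvalues: the zeros of `a` in the upper half-plane. -/
def eigenvalues (σ : ℝ) (r : ℝ → ℝ) : Set ℂ := {μ | 0 < μ.im ∧ coeffA σ r μ = 0}

/-- The normalization constant at an eigenvalue `μ`, defined by `Φ(·, μ) = c Ψ(·, μ)`. -/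
def normConst (σ : ℝ) (r : ℝ → ℝ) (μ : ℂ) : ℂ :=
  Classical.epsilon fun c : ℂ => ∀ x : ℝ, phi σ r μ x = c • psi σ r μ x

/-- The time derivative `r_t(x, t)` on `t ≥ 0` (one-sided at `t = 0`). -/
def timeDeriv (r : ℝ → ℝ → ℝ) (x t : ℝ) : ℝ := derivWithin (fun s => r x s) (Ici 0) t

/-- `r` is continuous, with a continuous time derivative, on `ℝ × [0, ∞)`. -/
structure IsRegular (r : ℝ → ℝ → ℝ) : Prop where
  cont : ContinuousOn (fun p : ℝ × ℝ => r p.1 p.2) (univ ×ˢ Ici 0)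
  diff : ∀ x : ℝ, ∀ t : ℝ, 0 ≤ t → DifferentiableWithinAt ℝ (fun s => r x s) (Ici 0) t
  cont_timeDeriv : ContinuousOn (fun p : ℝ × ℝ => timeDeriv r p.1 p.2) (univ ×ˢ Ici 0)

/-- Decay as `|x| → ∞`: locally uniformly in time, `r` and `r_t` are dominated by an integrable
function of `x` that tends to zero at infinity. -/
def Decays (r : ℝ → ℝ → ℝ) : Prop :=
  ∀ T : ℝ, ∃ g : ℝ → ℝ, Integrable g ∧ Tendsto g (cocompact ℝ) (𝓝 0) ∧
    ∀ x t : ℝ, 0 ≤ t → t ≤ T → |r x t| ≤ g x ∧ |timeDeriv r x t| ≤ g x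

/-- The evolution equation `r_{tx} = 2 σ r ∫_x^∞ (r²)_t dy + r` for `x ∈ ℝ`, `t ≥ 0`. -/
def SolvesEquation (σ : ℝ) (r : ℝ → ℝ → ℝ) : Prop :=
  ∀ x t : ℝ, 0 ≤ t →
    HasDerivAt (fun y => timeDeriv r y t)
      (2 * σ * r x t * (∫ y in Ioi x, timeDeriv (fun z s => r z s ^ 2) y t) + r x t) x

end ZS

end

namespace ZS

/-! Put S = r_t and C = 1/2 + σ ∫_x^∞ (r²)_t dy. The equation becomes S_x = 2rC, C_x = -2σrS, that
is, M = (C, σS; S, -C) satisfies M_x = [Q, M] with Q = (0, -σr; r, 0). Applying M to a solution of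
the Zakharov–Shabat system therefore leaves only a commutator with the spectral term, proportional
to μ; after multiplication by i/(2μ) it is exactly the forcing that appears when the system is
differentiated in t. Matching the behaviour at -∞ and +∞ gives Φ_t = (i/2μ)(M - C(-∞))Φ and Ψ_t =
(i/2μ)(M + C(+∞))Ψ (`phi_hasDerivWithinAt`, `psi_hasDerivWithinAt`, at x = 0). That Φ is
differentiable in t at all follows from the stability estimate `IsModSolution.sqrt_le`, applied to
the first-order Taylor remainder in `hasDerivWithinAt_of_linearized`; Ψ is reduced to Φ by
reflection.

Hence a_t = (i/2μ)(C(+∞) - C(-∞)) a, while b and c_j satisfy y_t = -(i/2μ)(C(+∞) + C(-∞)) y. Since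
C(+∞) = 1/2, everything rests on C(-∞) = 1/2, i.e. ∫ (r²)_t dy = 0, which is not assumed
(`half_add_integral_eq`). The quantity C² + σS² does not depend on x, so C(-∞) = ±1/2. If σ = -1,
then C² ≥ 1/4 and C cannot change sign. If σ = 1, continuity in t makes the sign the same at all
times; the minus sign would make a(iη, t) grow like e^{t/(2η)}, whereas |a| ≤ 1 and a(iη, 0) ≠ 0
once η > sup |r(·, 0)|.

The factor i/(2μ) excludes μ = 0. There Φ and Ψ are eigenvectors of M for opposite eigenvalues, and
their orthogonality makes a_t vanish. -/

theorem hasDerivAt_integral_Iic {E : Type*} [NormedAddCommGroup E] [NormedSpace ℝ E]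
    [CompleteSpace E] {f : ℝ → E} (hc : Continuous f) (hi : ∀ b, IntegrableOn f (Iic b)) (x : ℝ) :
    HasDerivAt (fun x => ∫ y in Iic x, f y) (f x) x := by
  have h : (fun x => ∫ y in Iic x, f y) = fun x => (∫ y in Iic 0, f y) + ∫ y in (0 : ℝ)..x, f y := by
    funext b
    rw [← intervalIntegral.integral_Iic_sub_Iic (hi 0) (hi b)]
    abel
  rw [h]
  exact (intervalIntegral.integral_hasDerivAt_right (hc.intervalIntegrable _ _)
    (hc.stronglyMeasurableAtFilter _ _) hc.continuousAt).const_add _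

theorem le_of_antitone_of_tendsto {f : ℝ → ℝ} (hf : Antitone f) {c : ℝ}
    (hc : Tendsto f atBot (𝓝 c)) (x : ℝ) : f x ≤ c :=
  ge_of_tendsto hc ((eventually_le_atBot x).mono fun _ hy => hf hy)

theorem norm_sign {σ : ℝ} (hσ : σ = 1 ∨ σ = -1) : ‖(σ : ℂ)‖ = 1 := by
  rcases hσ with rfl | rfl <;> simp

theorem sign_mul_self {σ : ℝ} (hσ : σ = 1 ∨ σ = -1) : (σ : ℂ) * σ = 1 := by
  rcases hσ with rfl | rfl <;> simp

/-- The system satisfied by `v = e^{iμx} u`, with an inhomogeneity `(f₁, f₂)`. -/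
def IsModSolution (σ : ℝ) (r : ℝ → ℝ) (μ : ℂ) (f₁ f₂ v₁ v₂ : ℝ → ℂ) : Prop :=
  ∀ x : ℝ, HasDerivAt v₁ (-(σ : ℂ) * r x * v₂ x + f₁ x) x ∧
    HasDerivAt v₂ ((r x : ℂ) * v₁ x + 2 * Complex.I * μ * v₂ x + f₂ x) x

/-! ### Energy estimate for the modulated system. -/

section Stability

variable {σ : ℝ} {r : ℝ → ℝ} {μ : ℂ} {f₁ f₂ v₁ v₂ : ℝ → ℂ}

/-- The coupling terms cost at most 2|ρ|‖a‖‖b‖, and 2iμ acts as a damping because Im μ ≥ 0. The left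
side is half the derivative of ‖v₁‖² + ‖v₂‖². -/
theorem IsModSolution.energy_le (hσ : σ = 1 ∨ σ = -1) (hμ : 0 ≤ μ.im) (a b f g : ℂ) (ρ : ℝ) :
    inner ℝ a (-(σ : ℂ) * ρ * b + f) + inner ℝ b ((ρ : ℂ) * a + 2 * Complex.I * μ * b + g) ≤
      |ρ| * (‖a‖ ^ 2 + ‖b‖ ^ 2) + ‖a‖ * ‖f‖ + ‖b‖ * ‖g‖ := by
  simp only [inner_add_right]
  have h1 : inner ℝ a (-(σ : ℂ) * ρ * b) ≤ ‖a‖ * (|ρ| * ‖b‖) := by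
    refine (real_inner_le_norm _ _).trans_eq ?_
    rw [norm_mul, norm_mul, norm_neg, norm_sign hσ]
    simp
  have h2 : inner ℝ b ((ρ : ℂ) * a) ≤ ‖b‖ * (|ρ| * ‖a‖) := by
    refine (real_inner_le_norm _ _).trans_eq ?_
    simp
  have h3 : inner ℝ b (2 * Complex.I * μ * b) ≤ 0 := by
    have : inner ℝ b (2 * Complex.I * μ * b) = -(2 * μ.im * (b.re ^ 2 + b.im ^ 2)) := by
      rw [Complex.inner]
      simp
      ring
    rw [this]
    have : 0 ≤ 2 * μ.im * (b.re ^ 2 + b.im ^ 2) := by positivity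
    linarith
  have h4 := real_inner_le_norm a f
  have h5 := real_inner_le_norm b g
  nlinarith [mul_nonneg (abs_nonneg ρ) (sq_nonneg (‖a‖ - ‖b‖))]

/-- Stability of the modulated system under forcing, with zero data at `-∞`. -/
theorem IsModSolution.sqrt_le (hσ : σ = 1 ∨ σ = -1) (hμ : 0 ≤ μ.im) (hr : Continuous r)
    (hri : Integrable r) (h : IsModSolution σ r μ f₁ f₂ v₁ v₂)
    (hv₁ : Tendsto v₁ atBot (𝓝 0)) (hv₂ : Tendsto v₂ atBot (𝓝 0))
    {e : ℝ → ℝ} (he : Continuous e) (hei : Integrable e) (hf : ∀ x, ‖f₁ x‖ + ‖f₂ x‖ ≤ e x)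
    (x : ℝ) : √(‖v₁ x‖ ^ 2 + ‖v₂ x‖ ^ 2) ≤ Real.exp (∫ y, |r y|) * ∫ y, e y := by
  have he0 : ∀ x, 0 ≤ e x := fun x => (by positivity : (0 : ℝ) ≤ ‖f₁ x‖ + ‖f₂ x‖).trans (hf x)
  set G : ℝ → ℝ := fun x => ∫ y in Iic x, |r y|
  set H : ℝ → ℝ := fun x => ∫ y in Iic x, e y
  have hG : ∀ x, HasDerivAt G |r x| x :=
    hasDerivAt_integral_Iic hr.abs fun _ => hri.abs.integrableOn
  have hH : ∀ x, HasDerivAt H (e x) x := hasDerivAt_integral_Iic he fun _ => hei.integrableOn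
  have hG0 : ∀ x, 0 ≤ G x := fun x => integral_nonneg fun _ => abs_nonneg _
  have hG1 : ∀ x, G x ≤ ∫ y, |r y| := fun x =>
    setIntegral_le_integral hri.abs (Eventually.of_forall fun _ => abs_nonneg _)
  have hH1 : ∀ x, H x ≤ ∫ y, e y := fun x =>
    setIntegral_le_integral hei (Eventually.of_forall he0)
  have hGl : Tendsto G atBot (𝓝 0) := tendsto_integral_Iic_zero tendsto_id
  have hHl : Tendsto H atBot (𝓝 0) := tendsto_integral_Iic_zero tendsto_id
  have key : ∀ ε > 0, √(‖v₁ x‖ ^ 2 + ‖v₂ x‖ ^ 2) * Real.exp (-G x) ≤ H x + ε := by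
    intro ε hε
    -- The ε² keeps the square root differentiable where v vanishes; ε is sent to 0 afterwards.
    set p : ℝ → ℝ := fun x => √(ε ^ 2 + (‖v₁ x‖ ^ 2 + ‖v₂ x‖ ^ 2))
    have hp0 : ∀ x, 0 < ε ^ 2 + (‖v₁ x‖ ^ 2 + ‖v₂ x‖ ^ 2) := fun x => by positivity
    have hp1 : ∀ x, 0 < p x := fun x => Real.sqrt_pos.2 (hp0 x)
    have hp2 : ∀ x, p x ^ 2 = ε ^ 2 + (‖v₁ x‖ ^ 2 + ‖v₂ x‖ ^ 2) := fun x => Real.sq_sqrt (hp0 x).le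
    have hpd := fun x => ((((h x).1.norm_sq).add ((h x).2.norm_sq)).const_add (ε ^ 2)).sqrt
      (hp0 x).ne'
    have hq := fun x => ((hpd x).mul (hG x).neg.exp).sub (hH x)
    -- Grönwall: p' ≤ |r| p + e and e^{-G} ≤ 1, so p e^{-G} - H is nonincreasing, with limit ε at
    -- -∞.
    have hanti := antitone_of_hasDerivAt_nonpos hq ?_
    · have hl : Tendsto (fun x => p x * Real.exp (-G x) - H x) atBot
          (𝓝 (√(ε ^ 2 + (‖(0 : ℂ)‖ ^ 2 + ‖(0 : ℂ)‖ ^ 2)) * Real.exp (-0) - 0)) :=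
        ((((hv₁.norm.pow 2).add (hv₂.norm.pow 2)).const_add _).sqrt.mul
          (Real.continuous_exp.continuousAt.tendsto.comp hGl.neg)).sub hHl
      have := le_of_antitone_of_tendsto hanti hl x
      simp only [norm_zero, ne_eq, OfNat.ofNat_ne_zero, not_false_eq_true, zero_pow, add_zero,
        Real.sqrt_sq hε.le, neg_zero, Real.exp_zero, mul_one, sub_zero] at this
      have h3 : √(‖v₁ x‖ ^ 2 + ‖v₂ x‖ ^ 2) ≤ p x :=
        Real.sqrt_le_sqrt (by nlinarith)
      have h4 := mul_le_mul_of_nonneg_right h3 (Real.exp_pos (-G x)).le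
      simp only [Pi.sub_apply, Pi.mul_apply] at this
      change p x * Real.exp (-G x) - H x ≤ ε at this
      linarith
    · intro x
      have hE : Real.exp (-G x) ≤ 1 := Real.exp_le_one_iff.2 (by linarith [hG0 x])
      have hE0 := Real.exp_pos (-G x)
      have hen := energy_le hσ hμ (v₁ x) (v₂ x) (f₁ x) (f₂ x) (r x)
      have ha : ‖v₁ x‖ ≤ p x := Real.le_sqrt_of_sq_le (by nlinarith [sq_nonneg ‖v₂ x‖])
      have hb : ‖v₂ x‖ ≤ p x := Real.le_sqrt_of_sq_le (by nlinarith [sq_nonneg ‖v₁ x‖])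
      set A := inner ℝ (v₁ x) (-(σ : ℂ) * r x * v₂ x + f₁ x)
      set B := inner ℝ (v₂ x) ((r x : ℂ) * v₁ x + 2 * Complex.I * μ * v₂ x + f₂ x)
      have hAB : A + B ≤ (|r x| * p x + e x) * p x := by
        have h1 := mul_le_mul_of_nonneg_right ha (norm_nonneg (f₁ x))
        have h2 := mul_le_mul_of_nonneg_right hb (norm_nonneg (f₂ x))
        have h3 := mul_le_mul_of_nonneg_left (hf x) (hp1 x).le
        have h4 : |r x| * (‖v₁ x‖ ^ 2 + ‖v₂ x‖ ^ 2) ≤ |r x| * p x ^ 2 :=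
          mul_le_mul_of_nonneg_left (by rw [hp2]; nlinarith) (abs_nonneg _)
        linarith
      have hd : (2 * A + 2 * B) / (2 * p x) ≤ |r x| * p x + e x := by
        rw [div_le_iff₀ (by linarith [hp1 x])]
        linarith
      change (2 * A + 2 * B) / (2 * p x) * Real.exp (-G x) +
        p x * (Real.exp (-G x) * -|r x|) - e x ≤ 0
      have h6 := mul_le_mul_of_nonneg_right hd hE0.le
      have h7 := mul_le_mul_of_nonneg_left hE (he0 x)
      nlinarith
  have h1 : √(‖v₁ x‖ ^ 2 + ‖v₂ x‖ ^ 2) * Real.exp (-G x) ≤ H x := le_of_forall_pos_le_add key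
  rw [Real.exp_neg, ← div_eq_mul_inv, div_le_iff₀ (Real.exp_pos _)] at h1
  refine h1.trans ?_
  rw [mul_comm]
  exact mul_le_mul (Real.exp_le_exp.2 (hG1 x)) (hH1 x) (integral_nonneg he0) (Real.exp_pos _).le

theorem IsModSolution.norm_le (hσ : σ = 1 ∨ σ = -1) (hμ : 0 ≤ μ.im) (hr : Continuous r)
    (hri : Integrable r) (h : IsModSolution σ r μ f₁ f₂ v₁ v₂)
    (hv₁ : Tendsto v₁ atBot (𝓝 0)) (hv₂ : Tendsto v₂ atBot (𝓝 0))
    {e : ℝ → ℝ} (he : Continuous e) (hei : Integrable e) (hf : ∀ x, ‖f₁ x‖ + ‖f₂ x‖ ≤ e x)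
    (x : ℝ) : ‖v₁ x‖ ≤ Real.exp (∫ y, |r y|) * ∫ y, e y ∧
      ‖v₂ x‖ ≤ Real.exp (∫ y, |r y|) * ∫ y, e y := by
  have := h.sqrt_le hσ hμ hr hri hv₁ hv₂ he hei hf x
  constructor
  · exact (Real.le_sqrt_of_sq_le (by nlinarith [sq_nonneg ‖v₂ x‖])).trans this
  · exact (Real.le_sqrt_of_sq_le (by nlinarith [sq_nonneg ‖v₁ x‖])).trans this

theorem IsModSolution.eq_zero (hσ : σ = 1 ∨ σ = -1) (hμ : 0 ≤ μ.im) (hr : Continuous r)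
    (hri : Integrable r) (h : IsModSolution σ r μ (fun _ => 0) (fun _ => 0) v₁ v₂)
    (hv₁ : Tendsto v₁ atBot (𝓝 0)) (hv₂ : Tendsto v₂ atBot (𝓝 0)) (x : ℝ) :
    v₁ x = 0 ∧ v₂ x = 0 := by
  have := h.norm_le hσ hμ hr hri hv₁ hv₂ (e := fun _ => 0) continuous_const
    (integrable_zero _ _ _) (by simp) x
  simpa using this

end Stability

end ZS

namespace ZS

/-! ### Existence of the modulated Jost solution by a Volterra contraction. -/

section Existence

variable {r : ℝ → ℝ}

/-- The weight `exp (2 ∫_{-∞}^x |r|)` in which the Volterra operator is a contraction. -/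
noncomputable def weight (r : ℝ → ℝ) (x : ℝ) : ℝ := Real.exp (2 * ∫ y in Iic x, |r y|)

theorem one_le_weight (r : ℝ → ℝ) (x : ℝ) : 1 ≤ weight r x :=
  Real.one_le_exp (mul_nonneg zero_le_two (integral_nonneg fun _ => abs_nonneg _))

theorem weight_pos (r : ℝ → ℝ) (x : ℝ) : 0 < weight r x := Real.exp_pos _

theorem weight_le (hri : Integrable r) (x : ℝ) : weight r x ≤ Real.exp (2 * ∫ y, |r y|) :=
  Real.exp_le_exp.2 (mul_le_mul_of_nonneg_left
    (setIntegral_le_integral hri.abs (Eventually.of_forall fun _ => abs_nonneg _)) zero_le_two)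

theorem hasDerivAt_weight (hr : Continuous r) (hri : Integrable r) (x : ℝ) :
    HasDerivAt (weight r) (2 * |r x| * weight r x) x := by
  have := ((hasDerivAt_integral_Iic hr.abs (fun _ => hri.abs.integrableOn) x).const_mul 2).exp
  rw [mul_comm]
  exact this

theorem continuous_weight (hr : Continuous r) (hri : Integrable r) : Continuous (weight r) :=
  continuous_iff_continuousAt.2 fun x => (hasDerivAt_weight hr hri x).continuousAt

theorem tendsto_weight (r : ℝ → ℝ) : Tendsto (weight r) atBot (𝓝 1) := by
  have h : Tendsto (fun x => ∫ y in Iic x, |r y|) atBot (𝓝 0) :=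
    tendsto_integral_Iic_zero tendsto_id
  have h1 := Real.continuous_exp.continuousAt.tendsto.comp (h.const_mul 2)
  rw [mul_zero, Real.exp_zero] at h1
  exact h1

theorem integrable_weight_mul (hr : Continuous r) (hri : Integrable r) :
    Integrable fun x => weight r x * |r x| := by
  refine hri.abs.bdd_mul (continuous_weight hr hri).aestronglyMeasurable
    (c := Real.exp (2 * ∫ y, |r y|)) (Eventually.of_forall fun x => ?_)
  rw [Real.norm_of_nonneg (weight_pos r x).le]
  exact weight_le hri x

/-- The weight W satisfies W' = 2|r|W; this 2 is the source of the contraction constant 1/2. -/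
theorem integral_weight_mul (hr : Continuous r) (hri : Integrable r) (x : ℝ) :
    ∫ y in Iic x, weight r y * |r y| = (weight r x - 1) / 2 := by
  rw [sub_div]
  refine integral_Iic_of_hasDerivAt_of_tendsto' (f := fun x => weight r x / 2) (fun y _ => ?_)
    (integrable_weight_mul hr hri).integrableOn ((tendsto_weight r).div_const 2)
  have h := (hasDerivAt_weight hr hri y).div_const 2
  rwa [mul_assoc, mul_div_cancel_left₀ _ two_ne_zero, mul_comm] at h

/-- The weighted Volterra integral with kernel `κ`. -/
noncomputable def volterra (r : ℝ → ℝ) (κ u : ℝ → ℂ) (x : ℝ) : ℂ :=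
  ∫ y in Iic x, κ y * ((weight r y * r y : ℝ) * u y)

variable {κ u u' : ℝ → ℂ} {B : ℝ}

/-- Monotonicity of ‖κ‖ is the only trace of Im μ ≥ 0: it bounds the kernel κ(y)/κ(x) by 1 for y ≤
x. -/
theorem norm_volterra_integrand_le (hκm : Monotone fun x => ‖κ x‖) (hB : ∀ x, ‖u x‖ ≤ B)
    {x y : ℝ} (hy : y ≤ x) :
    ‖κ y * ((weight r y * r y : ℝ) * u y)‖ ≤ ‖κ x‖ * B * (weight r y * |r y|) := by
  rw [norm_mul, norm_mul, Complex.norm_real, norm_mul, Real.norm_of_nonneg (weight_pos r y).le,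
    Real.norm_eq_abs]
  have h0 : 0 ≤ weight r y * |r y| := mul_nonneg (weight_pos r y).le (abs_nonneg _)
  calc ‖κ y‖ * (weight r y * |r y| * ‖u y‖)
      ≤ ‖κ x‖ * (weight r y * |r y| * B) :=
        mul_le_mul (hκm hy) (mul_le_mul_of_nonneg_left (hB y) h0)
          (mul_nonneg h0 (norm_nonneg _)) (norm_nonneg _)
    _ = _ := by ring

theorem continuous_volterra_integrand (hr : Continuous r) (hri : Integrable r) (hκ : Continuous κ)
    (hu : Continuous u) : Continuous fun y => κ y * ((weight r y * r y : ℝ) * u y) :=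
  hκ.mul ((Complex.continuous_ofReal.comp ((continuous_weight hr hri).mul hr)).mul hu)

theorem integrableOn_volterra (hr : Continuous r) (hri : Integrable r) (hκ : Continuous κ)
    (hκm : Monotone fun x => ‖κ x‖) (hu : Continuous u) (hB : ∀ x, ‖u x‖ ≤ B) (x : ℝ) :
    IntegrableOn (fun y => κ y * ((weight r y * r y : ℝ) * u y)) (Iic x) := by
  refine Integrable.mono' (g := fun y => ‖κ x‖ * B * (weight r y * |r y|))
    ((integrable_weight_mul hr hri).const_mul _).integrableOn
    (continuous_volterra_integrand hr hri hκ hu).aestronglyMeasurable ?_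
  exact (ae_restrict_iff' measurableSet_Iic).2
    (Eventually.of_forall fun y hy => norm_volterra_integrand_le hκm hB hy)

theorem hasDerivAt_volterra (hr : Continuous r) (hri : Integrable r) (hκ : Continuous κ)
    (hκm : Monotone fun x => ‖κ x‖) (hu : Continuous u) (hB : ∀ x, ‖u x‖ ≤ B) (x : ℝ) :
    HasDerivAt (volterra r κ u) (κ x * ((weight r x * r x : ℝ) * u x)) x :=
  hasDerivAt_integral_Iic (continuous_volterra_integrand hr hri hκ hu)
    (integrableOn_volterra hr hri hκ hκm hu hB) x

theorem norm_volterra_le (hr : Continuous r) (hri : Integrable r)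
    (hκm : Monotone fun x => ‖κ x‖) (hB : ∀ x, ‖u x‖ ≤ B) (x : ℝ) :
    ‖volterra r κ u x‖ ≤ ‖κ x‖ * (B * ((weight r x - 1) / 2)) := by
  rw [← integral_weight_mul hr hri, ← mul_assoc, ← integral_const_mul]
  refine norm_integral_le_of_norm_le
    (((integrable_weight_mul hr hri).const_mul _).integrableOn) ?_
  exact (ae_restrict_iff' measurableSet_Iic).2
    (Eventually.of_forall fun y hy => norm_volterra_integrand_le hκm hB hy)

theorem norm_inv_mul_volterra_le (hr : Continuous r) (hri : Integrable r)
    (hκm : Monotone fun x => ‖κ x‖) (hκ0 : ∀ x, κ x ≠ 0) (hB : ∀ x, ‖u x‖ ≤ B) (x : ℝ) :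
    ‖(κ x)⁻¹ * volterra r κ u x‖ ≤ B * ((weight r x - 1) / 2) := by
  rw [norm_mul, norm_inv, inv_mul_le_iff₀ (norm_pos_iff.2 (hκ0 x))]
  exact norm_volterra_le hr hri hκm hB x

theorem volterra_sub (hr : Continuous r) (hri : Integrable r) (hκ : Continuous κ)
    (hκm : Monotone fun x => ‖κ x‖) (hu : Continuous u) (hu' : Continuous u') {B' : ℝ}
    (hB : ∀ x, ‖u x‖ ≤ B) (hB' : ∀ x, ‖u' x‖ ≤ B') (x : ℝ) :
    volterra r κ u x - volterra r κ u' x = volterra r κ (fun y => u y - u' y) x := by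
  rw [volterra, volterra, ← integral_sub (integrableOn_volterra hr hri hκ hκm hu hB x)
    (integrableOn_volterra hr hri hκ hκm hu' hB' x)]
  simp only [volterra, mul_sub]

open scoped BoundedContinuousFunction

/-- The unknown is w = v/W with W the weight. Since W⁻¹(W - 1)/2 ≤ 1/2, the integral operator
contracts by 1/2 in the sup norm whatever the size of ∫ |r|. -/
theorem exists_volterra_fixedPoint {σ : ℝ} (hσ : σ = 1 ∨ σ = -1) (hr : Continuous r)
    (hri : Integrable r) (hκ : Continuous κ) (hκm : Monotone fun x => ‖κ x‖) (hκ0 : ∀ x, κ x ≠ 0) :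
    ∃ w₁ w₂ : ℝ → ℂ, ∃ B : ℝ, Continuous w₁ ∧ Continuous w₂ ∧ (∀ x, ‖w₁ x‖ ≤ B) ∧
      (∀ x, ‖w₂ x‖ ≤ B) ∧
      (∀ x, weight r x * w₁ x = 1 - σ * volterra r (fun _ => 1) w₂ x) ∧
      ∀ x, weight r x * w₂ x = (κ x)⁻¹ * volterra r κ w₁ x := by
  have hk1 : Monotone fun _ : ℝ => ‖(1 : ℂ)‖ := monotone_const
  have hw1 : ∀ x, (weight r x)⁻¹ ≤ 1 := fun x => inv_le_one_of_one_le₀ (one_le_weight r x)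
  have hW : ∀ x, ‖((weight r x : ℝ) : ℂ)⁻¹‖ = (weight r x)⁻¹ := fun x => by
    rw [norm_inv, Complex.norm_real, Real.norm_of_nonneg (weight_pos r x).le]
  have hhalf : ∀ x (B : ℝ), 0 ≤ B → (weight r x)⁻¹ * (B * ((weight r x - 1) / 2)) ≤ 1 / 2 * B := by
    intro x B hB
    rw [inv_mul_le_iff₀ (weight_pos r x)]
    nlinarith [mul_nonneg hB (weight_pos r x).le]
  have hfst : ∀ (w : ℝ →ᵇ ℂ × ℂ) x, ‖(w x).1‖ ≤ ‖w‖ := fun w x =>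
    (norm_fst_le _).trans (w.norm_coe_le_norm x)
  have hsnd : ∀ (w : ℝ →ᵇ ℂ × ℂ) x, ‖(w x).2‖ ≤ ‖w‖ := fun w x =>
    (norm_snd_le _).trans (w.norm_coe_le_norm x)
  have hcf : ∀ w : ℝ →ᵇ ℂ × ℂ, Continuous fun x => (w x).1 := fun w => w.continuous.fst
  have hcs : ∀ w : ℝ →ᵇ ℂ × ℂ, Continuous fun x => (w x).2 := fun w => w.continuous.snd
  have hWc : Continuous fun x => ((weight r x : ℝ) : ℂ)⁻¹ :=
    (Complex.continuous_ofReal.comp (continuous_weight hr hri)).inv₀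
      fun x => Complex.ofReal_ne_zero.2 (weight_pos r x).ne'
  set V₁ : (ℝ →ᵇ ℂ × ℂ) → ℝ → ℂ := fun w => volterra r (fun _ => 1) fun y => (w y).2
  set V₂ : (ℝ →ᵇ ℂ × ℂ) → ℝ → ℂ := fun w => volterra r κ fun y => (w y).1
  have hV₁c : ∀ w, Continuous (V₁ w) := fun w => continuous_iff_continuousAt.2 fun x =>
    (hasDerivAt_volterra hr hri continuous_const hk1 (hcs w) (hsnd w) x).continuousAt
  have hV₂c : ∀ w, Continuous (V₂ w) := fun w => continuous_iff_continuousAt.2 fun x =>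
    (hasDerivAt_volterra hr hri hκ hκm (hcf w) (hfst w) x).continuousAt
  have hV₁n : ∀ w x, ‖V₁ w x‖ ≤ ‖w‖ * ((weight r x - 1) / 2) := fun w x => by
    simpa using norm_inv_mul_volterra_le hr hri hk1 (fun _ => one_ne_zero) (hsnd w) x
  have hV₂n : ∀ w x, ‖(κ x)⁻¹ * V₂ w x‖ ≤ ‖w‖ * ((weight r x - 1) / 2) := fun w x =>
    norm_inv_mul_volterra_le hr hri hκm hκ0 (hfst w) x
  have hV₁s : ∀ w w' x, V₁ w x - V₁ w' x = V₁ (w - w') x := fun w w' x =>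
    volterra_sub hr hri continuous_const hk1 (hcs w) (hcs w') (hsnd w) (hsnd w') x
  have hV₂s : ∀ w w' x, V₂ w x - V₂ w' x = V₂ (w - w') x := fun w w' x =>
    volterra_sub hr hri hκ hκm (hcf w) (hcf w') (hfst w) (hfst w') x
  let T : (ℝ →ᵇ ℂ × ℂ) → (ℝ →ᵇ ℂ × ℂ) := fun w =>
    BoundedContinuousFunction.ofNormedAddCommGroup
      (fun x => ((weight r x : ℂ)⁻¹ * (1 - σ * V₁ w x), (weight r x : ℂ)⁻¹ * ((κ x)⁻¹ * V₂ w x)))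
      ((hWc.mul (continuous_const.sub (continuous_const.mul (hV₁c w)))).prodMk
        (hWc.mul ((hκ.inv₀ hκ0).mul (hV₂c w)))) (1 + 1 / 2 * ‖w‖) (by
        intro x
        refine norm_prod_le_iff.2 ⟨?_, ?_⟩
        · rw [norm_mul, hW]
          have h1 : ‖1 - σ * V₁ w x‖ ≤ 1 + ‖w‖ * ((weight r x - 1) / 2) := by
            refine (norm_sub_le _ _).trans ?_
            rw [norm_mul, norm_sign hσ, norm_one, one_mul]
            linarith [hV₁n w x]
          refine (mul_le_mul_of_nonneg_left h1 (inv_pos.2 (weight_pos r x)).le).trans ?_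
          rw [mul_add, mul_one]
          exact add_le_add (hw1 x) (hhalf x _ (norm_nonneg _))
        · rw [norm_mul, hW]
          refine (mul_le_mul_of_nonneg_left (hV₂n w x) (inv_pos.2 (weight_pos r x)).le).trans ?_
          linarith [hhalf x ‖w‖ (norm_nonneg _)])
  have hT : ContractingWith (1 / 2) T := by
    refine ⟨by rw [div_lt_one] <;> norm_num, LipschitzWith.of_dist_le_mul fun w w' => ?_⟩
    rw [BoundedContinuousFunction.dist_le (by positivity)]
    intro x
    have hd : dist w w' = ‖w - w'‖ := dist_eq_norm _ _
    have hcast : ((1 / 2 : NNReal) : ℝ) = 1 / 2 := by norm_num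
    rw [hd, hcast, dist_eq_norm]
    refine norm_prod_le_iff.2 ⟨?_, ?_⟩
    · change ‖(weight r x : ℂ)⁻¹ * (1 - σ * V₁ w x) - (weight r x : ℂ)⁻¹ * (1 - σ * V₁ w' x)‖ ≤ _
      rw [← mul_sub, sub_sub_sub_cancel_left, ← mul_sub, norm_mul, norm_mul, hW, norm_sign hσ,
        one_mul, norm_sub_rev, hV₁s]
      exact (mul_le_mul_of_nonneg_left (hV₁n _ x) (inv_pos.2 (weight_pos r x)).le).trans
        (hhalf x _ (norm_nonneg _))
    · change ‖(weight r x : ℂ)⁻¹ * ((κ x)⁻¹ * V₂ w x) -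
        (weight r x : ℂ)⁻¹ * ((κ x)⁻¹ * V₂ w' x)‖ ≤ _
      rw [← mul_sub, ← mul_sub, hV₂s, norm_mul, hW]
      exact (mul_le_mul_of_nonneg_left (hV₂n _ x) (inv_pos.2 (weight_pos r x)).le).trans
        (hhalf x _ (norm_nonneg _))
  have hfix := hT.fixedPoint_isFixedPt
  set w := ContractingWith.fixedPoint T hT
  have hx : ∀ x, w x = ((weight r x : ℂ)⁻¹ * (1 - σ * V₁ w x),
      (weight r x : ℂ)⁻¹ * ((κ x)⁻¹ * V₂ w x)) := fun x =>
    (DFunLike.congr_fun hfix x).symm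
  have h0 : ∀ x, (weight r x : ℂ) ≠ 0 := fun x => Complex.ofReal_ne_zero.2 (weight_pos r x).ne'
  refine ⟨fun x => (w x).1, fun x => (w x).2, ‖w‖, hcf w, hcs w, hfst w, hsnd w, fun x => ?_,
    fun x => ?_⟩
  · change _ * (w x).1 = _
    rw [congrArg Prod.fst (hx x), mul_inv_cancel_left₀ (h0 x)]
  · change _ * (w x).2 = _
    rw [congrArg Prod.snd (hx x), mul_inv_cancel_left₀ (h0 x)]

theorem exists_isModSolution {σ : ℝ} {μ : ℂ} (hσ : σ = 1 ∨ σ = -1) (hμ : 0 ≤ μ.im)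
    (hr : Continuous r) (hri : Integrable r) :
    ∃ v₁ v₂ : ℝ → ℂ, IsModSolution σ r μ (fun _ => 0) (fun _ => 0) v₁ v₂ ∧
      Tendsto v₁ atBot (𝓝 1) ∧ Tendsto v₂ atBot (𝓝 0) := by
  -- Integrating factor of v₂' = r v₁ + 2iμ v₂; its modulus e^{2 Im μ x} is nondecreasing.
  set κ : ℝ → ℂ := fun x => Complex.exp (-(2 * Complex.I * μ) * x)
  have hκ : Continuous κ := by fun_prop
  have hκ0 : ∀ x, κ x ≠ 0 := fun x => Complex.exp_ne_zero _
  have hκm : Monotone fun x => ‖κ x‖ := by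
    intro x y hxy
    simp only [κ, Complex.norm_exp]
    refine Real.exp_le_exp.2 ?_
    simp
    nlinarith
  have hκd : ∀ x, HasDerivAt (fun x => (κ x)⁻¹) (2 * Complex.I * μ * (κ x)⁻¹) x := by
    intro x
    have h1 : (fun x => (κ x)⁻¹) = fun x : ℝ => Complex.exp (2 * Complex.I * μ * x) := by
      funext y
      rw [← Complex.exp_neg]
      congr 1
      ring
    rw [congrFun h1 x, h1, mul_comm (2 * Complex.I * μ) (Complex.exp _)]
    simpa using ((Complex.ofRealCLM.hasDerivAt (x := x)).const_mul (2 * Complex.I * μ)).cexp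
  obtain ⟨w₁, w₂, B, hc₁, hc₂, hB₁, hB₂, h₁, h₂⟩ :=
    exists_volterra_fixedPoint hσ hr hri hκ hκm hκ0
  have hB : Tendsto (fun x => B * ((weight r x - 1) / 2)) atBot (𝓝 0) := by
    simpa using (((tendsto_weight r).sub_const 1).div_const 2).const_mul B
  refine ⟨fun x => weight r x * w₁ x, fun x => weight r x * w₂ x, fun x => ⟨?_, ?_⟩, ?_, ?_⟩
  · have hd := ((hasDerivAt_volterra (κ := fun _ => 1) hr hri continuous_const monotone_const hc₂ hB₂ x).const_mul
      (σ : ℂ)).const_sub 1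
    rw [funext h₁]
    refine hd.congr_deriv ?_
    push_cast
    ring
  · have hd := (hκd x).mul (hasDerivAt_volterra hr hri hκ hκm hc₁ hB₁ x)
    rw [funext h₂]
    refine hd.congr_deriv ?_
    rw [inv_mul_cancel_left₀ (hκ0 x)]
    push_cast
    ring
  · rw [funext h₁]
    have : Tendsto (volterra r (fun _ => 1) w₂) atBot (𝓝 0) := squeeze_zero_norm (fun x => by
      simpa using norm_volterra_le hr hri (κ := fun _ => 1) monotone_const hB₂ x) hB
    simpa using (this.const_mul (σ : ℂ)).const_sub 1
  · rw [funext h₂]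
    exact squeeze_zero_norm (norm_inv_mul_volterra_le hr hri hκm hκ0 hB₁) hB

end Existence

end ZS

namespace ZS

/-! ### Existence, uniqueness and symmetries of Φ, Ψ and Ψ̄. -/

section JostSolutions

variable {σ : ℝ} {r r' : ℝ → ℝ} {μ : ℂ} {u w : ℝ → ℂ × ℂ}

theorem hasDerivAt_cexp_mul (c : ℂ) (x : ℝ) :
    HasDerivAt (fun x : ℝ => Complex.exp (c * x)) (c * Complex.exp (c * x)) x := by
  rw [mul_comm c (Complex.exp _)]
  simpa using ((Complex.ofRealCLM.hasDerivAt (x := x)).const_mul c).cexp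

theorem IsSolution.isModSolution (h : IsSolution σ r μ u) :
    IsModSolution σ r μ (fun _ => 0) (fun _ => 0)
      (fun x => Complex.exp (Complex.I * μ * x) * (u x).1)
      (fun x => Complex.exp (Complex.I * μ * x) * (u x).2) := by
  refine fun x => ⟨((hasDerivAt_cexp_mul _ x).mul (h x).1).congr_deriv ?_,
    ((hasDerivAt_cexp_mul _ x).mul (h x).2).congr_deriv ?_⟩ <;> ring

theorem IsModSolution.isSolution {v₁ v₂ : ℝ → ℂ}
    (h : IsModSolution σ r μ (fun _ => 0) (fun _ => 0) v₁ v₂) :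
    IsSolution σ r μ fun x => Complex.exp (-(Complex.I * μ) * x) • (v₁ x, v₂ x) := by
  refine fun x => ⟨((hasDerivAt_cexp_mul _ x).mul (h x).1).congr_deriv ?_,
    ((hasDerivAt_cexp_mul _ x).mul (h x).2).congr_deriv ?_⟩ <;>
  simp only [Prod.smul_mk, smul_eq_mul] <;> ring

theorem IsPhi.tendsto_fst (h : IsPhi σ r μ u) :
    Tendsto (fun x : ℝ => Complex.exp (Complex.I * μ * x) * (u x).1) atBot (𝓝 1) :=
  (continuous_fst.tendsto _).comp h.2

theorem IsPhi.tendsto_snd (h : IsPhi σ r μ u) :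
    Tendsto (fun x : ℝ => Complex.exp (Complex.I * μ * x) * (u x).2) atBot (𝓝 0) :=
  (continuous_snd.tendsto _).comp h.2

theorem IsPhi.unique (hσ : σ = 1 ∨ σ = -1) (hμ : 0 ≤ μ.im) (hr : Continuous r)
    (hri : Integrable r) (h : IsPhi σ r μ u) (h' : IsPhi σ r μ w) : u = w := by
  have hd : IsModSolution σ r μ (fun _ => 0) (fun _ => 0)
      (fun x => Complex.exp (Complex.I * μ * x) * (u x).1 -
        Complex.exp (Complex.I * μ * x) * (w x).1)
      (fun x => Complex.exp (Complex.I * μ * x) * (u x).2 -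
        Complex.exp (Complex.I * μ * x) * (w x).2) := fun x =>
    ⟨((h.1.isModSolution x).1.sub (h'.1.isModSolution x).1).congr_deriv (by ring),
      ((h.1.isModSolution x).2.sub (h'.1.isModSolution x).2).congr_deriv (by ring)⟩
  funext x
  have := hd.eq_zero hσ hμ hr hri (by simpa using h.tendsto_fst.sub h'.tendsto_fst)
    (by simpa using h.tendsto_snd.sub h'.tendsto_snd) x
  simp only [← mul_sub, mul_eq_zero, Complex.exp_ne_zero, false_or, sub_eq_zero] at this
  exact Prod.ext this.1 this.2

theorem exists_isPhi (hσ : σ = 1 ∨ σ = -1) (hμ : 0 ≤ μ.im) (hr : Continuous r)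
    (hri : Integrable r) : ∃ u, IsPhi σ r μ u := by
  obtain ⟨v₁, v₂, hv, h₁, h₂⟩ := exists_isModSolution hσ hμ hr hri
  refine ⟨_, hv.isSolution, ?_⟩
  have : (fun x : ℝ => Complex.exp (Complex.I * μ * x) •
      Complex.exp (-(Complex.I * μ) * x) • (v₁ x, v₂ x)) = fun x => (v₁ x, v₂ x) := by
    funext x
    rw [smul_smul, ← Complex.exp_add]
    simp
  rw [this]
  exact h₁.prodMk_nhds h₂

theorem isPhi_phi (hσ : σ = 1 ∨ σ = -1) (hμ : 0 ≤ μ.im) (hr : Continuous r)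
    (hri : Integrable r) : IsPhi σ r μ (phi σ r μ) :=
  Classical.epsilon_spec (exists_isPhi hσ hμ hr hri)

/-- The reflected potential `x ↦ σ r(-x)`; reflection exchanges `Φ` and `Ψ`. -/
def reflect (σ : ℝ) (r : ℝ → ℝ) (x : ℝ) : ℝ := σ * r (-x)

theorem reflect_reflect (hσ : σ = 1 ∨ σ = -1) (r : ℝ → ℝ) : reflect σ (reflect σ r) = r := by
  funext x
  rcases hσ with rfl | rfl <;> simp [reflect]

theorem continuous_reflect (hr : Continuous r) : Continuous (reflect σ r) :=
  continuous_const.mul (hr.comp continuous_neg)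

theorem integrable_reflect (hri : Integrable r) : Integrable (reflect σ r) :=
  hri.comp_neg.const_mul σ

/-- Reversing x changes the sign of both right sides, and swapping the components restores the ±iμ;
σ² = 1 turns the couplings into those of the potential σ r(-x). Every statement about Ψ is thereby
one about Φ. -/
theorem IsSolution.reflect (hσ : σ = 1 ∨ σ = -1) (h : IsSolution σ r μ u) :
    IsSolution σ (reflect σ r) μ fun x => (u (-x)).swap := by
  intro x
  have h1 := (h (-x)).1.scomp x (hasDerivAt_neg x)
  have h2 := (h (-x)).2.scomp x (hasDerivAt_neg x)
  refine ⟨h2.congr_deriv ?_, h1.congr_deriv ?_⟩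
  · simp only [neg_smul, one_smul, ZS.reflect, Prod.fst_swap, Prod.snd_swap]
    push_cast
    linear_combination ((r (-x) : ℂ) * (u (-x)).1) * sign_mul_self hσ
  · simp only [neg_smul, one_smul, ZS.reflect, Prod.fst_swap, Prod.snd_swap]
    push_cast
    ring

theorem IsPsi.reflect (hσ : σ = 1 ∨ σ = -1) (h : IsPsi σ r μ u) :
    IsPhi σ (reflect σ r) μ fun x => (u (-x)).swap := by
  refine ⟨h.1.reflect hσ, ?_⟩
  have := (continuous_swap.tendsto _).comp (h.2.comp tendsto_neg_atBot_atTop)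
  refine this.congr fun x => ?_
  simp

theorem IsPhi.reflect (hσ : σ = 1 ∨ σ = -1) (h : IsPhi σ r μ u) :
    IsPsi σ (reflect σ r) μ fun x => (u (-x)).swap := by
  refine ⟨h.1.reflect hσ, ?_⟩
  have := (continuous_swap.tendsto _).comp (h.2.comp tendsto_neg_atTop_atBot)
  refine this.congr fun x => ?_
  simp

theorem isPsi_psi (hσ : σ = 1 ∨ σ = -1) (hμ : 0 ≤ μ.im) (hr : Continuous r)
    (hri : Integrable r) : IsPsi σ r μ (psi σ r μ) := by
  obtain ⟨u, hu⟩ := exists_isPhi hσ hμ (continuous_reflect (σ := σ) hr) (integrable_reflect hri)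
  have h := hu.reflect hσ
  rw [reflect_reflect hσ] at h
  exact Classical.epsilon_spec ⟨_, h⟩

theorem IsPsi.unique (hσ : σ = 1 ∨ σ = -1) (hμ : 0 ≤ μ.im) (hr : Continuous r)
    (hri : Integrable r) (h : IsPsi σ r μ u) (h' : IsPsi σ r μ w) : u = w := by
  have := (h.reflect hσ).unique hσ hμ (continuous_reflect hr) (integrable_reflect hri)
    (h'.reflect hσ)
  funext x
  have hx := congrFun this (-x)
  simpa using hx

theorem swap_psi (hσ : σ = 1 ∨ σ = -1) (hμ : 0 ≤ μ.im) (hr : Continuous r)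
    (hri : Integrable r) (x : ℝ) :
    (psi σ r μ (-x)).swap = phi σ (reflect σ r) μ x :=
  congrFun (((isPsi_psi hσ hμ hr hri).reflect hσ).unique hσ hμ (continuous_reflect hr)
    (integrable_reflect hri) (isPhi_phi hσ hμ (continuous_reflect hr) (integrable_reflect hri))) x

open scoped ComplexConjugate

theorem hasDerivAt_conj {f : ℝ → ℂ} {f' : ℂ} {x : ℝ} (h : HasDerivAt f f' x) :
    HasDerivAt (fun x => conj (f x)) (conj f') x :=
  h.star

theorem conj_exp_real (c : ℂ) (hc : conj c = -c) (x : ℝ) :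
    conj (Complex.exp (c * x)) = Complex.exp (-c * x) := by
  rw [← Complex.exp_conj, map_mul, hc, Complex.conj_ofReal]

/-- For real spectral parameter, conjugation exchanges the exponents ±iμ. It links Ψ and Ψ̄; the
constant `c` adjusts the normalization, -σ in one direction and 1 in the other. -/
theorem IsSolution.conj {m : ℝ} (h : IsSolution σ r m u) (c : ℂ) :
    IsSolution σ r m fun x => (-σ * c * conj (u x).2, c * conj (u x).1) := by
  intro x
  have h1 := hasDerivAt_conj (h x).1
  have h2 := hasDerivAt_conj (h x).2
  refine ⟨(h2.const_mul (-σ * c)).congr_deriv ?_, (h1.const_mul c).congr_deriv ?_⟩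
  · simp only [map_add, map_mul, Complex.conj_I, Complex.conj_ofReal]
    ring
  · simp only [map_mul, map_sub, map_neg, Complex.conj_I, Complex.conj_ofReal]
    ring

theorem isPsiBar_psiBar {m : ℝ} (hσ : σ = 1 ∨ σ = -1) (hr : Continuous r) (hri : Integrable r) :
    IsPsiBar σ r m (psiBar σ r m) := by
  have hm : 0 ≤ (m : ℂ).im := by simp
  have h := isPsi_psi hσ hm hr hri
  refine Classical.epsilon_spec ⟨_, h.1.conj (-σ), ?_⟩
  have hσσ := sign_mul_self hσ
  have h1 : Tendsto (fun x : ℝ => conj (Complex.exp (-Complex.I * m * x) * (psi σ r m x).1))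
      atTop (𝓝 (conj 0)) :=
    (Complex.continuous_conj.tendsto _).comp ((continuous_fst.tendsto _).comp h.2)
  have h2 : Tendsto (fun x : ℝ => conj (Complex.exp (-Complex.I * m * x) * (psi σ r m x).2))
      atTop (𝓝 (conj 1)) :=
    (Complex.continuous_conj.tendsto _).comp ((continuous_snd.tendsto _).comp h.2)
  have h3 := h2.prodMk_nhds (h1.const_mul (-(σ : ℂ)))
  simp only [map_zero, mul_zero, map_one] at h3
  refine h3.congr fun x => ?_
  have he : conj (Complex.exp (-Complex.I * m * x)) = Complex.exp (Complex.I * m * x) := by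
    rw [conj_exp_real _ (by simp)]
    simp
  ext1
  · simp only [map_mul, he, Prod.smul_mk, smul_eq_mul, neg_mul_neg, hσσ, one_mul]
  · simp only [map_mul, he, Prod.smul_mk, smul_eq_mul]
    ring

/-- The conjugate of Ψ̄ has the asymptotics of Ψ, so uniqueness of Ψ suffices. The time evolution of
Ψ̄ is then read off from that of Ψ. -/
theorem psiBar_eq {m : ℝ} (hσ : σ = 1 ∨ σ = -1) (hr : Continuous r) (hri : Integrable r) (x : ℝ) :
    psiBar σ r m x = (conj (psi σ r m x).2, -σ * conj (psi σ r m x).1) := by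
  have hm : 0 ≤ (m : ℂ).im := by simp
  have h := isPsiBar_psiBar (m := m) hσ hr hri
  have hσσ := sign_mul_self hσ
  have h1 : Tendsto (fun x : ℝ => conj (Complex.exp (Complex.I * m * x) * (psiBar σ r m x).1))
      atTop (𝓝 (conj 1)) :=
    (Complex.continuous_conj.tendsto _).comp ((continuous_fst.tendsto _).comp h.2)
  have h2 : Tendsto (fun x : ℝ => conj (Complex.exp (Complex.I * m * x) * (psiBar σ r m x).2))
      atTop (𝓝 (conj 0)) :=
    (Complex.continuous_conj.tendsto _).comp ((continuous_snd.tendsto _).comp h.2)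
  have h3 := (h2.const_mul (-(σ : ℂ))).prodMk_nhds h1
  simp only [map_zero, mul_zero, map_one] at h3
  have hP : IsPsi σ r m fun x => (-σ * 1 * conj (psiBar σ r m x).2, 1 * conj (psiBar σ r m x).1) := by
    refine ⟨h.1.conj 1, h3.congr fun x => ?_⟩
    have he : conj (Complex.exp (Complex.I * m * x)) = Complex.exp (-Complex.I * m * x) := by
      rw [conj_exp_real _ (by simp)]
      simp
    ext1
    · simp only [map_mul, he, Prod.smul_mk, smul_eq_mul]
      ring
    · simp only [map_mul, he, Prod.smul_mk, smul_eq_mul, one_mul]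
  rw [(isPsi_psi hσ hm hr hri).unique hσ hm hr hri hP]
  ext1
  · simp
  · simp only [map_mul, map_neg, Complex.conj_ofReal, Complex.conj_conj, mul_one]
    linear_combination (-(psiBar σ r m x).2) * hσσ

end JostSolutions

/-! ### Wronskians and linear dependence of solutions. -/

section Wronskian

variable {σ : ℝ} {r : ℝ → ℝ} {μ : ℂ} {u w : ℝ → ℂ × ℂ}

theorem IsSolution.wronskian_eq (h : IsSolution σ r μ u) (h' : IsSolution σ r μ w) (x y : ℝ) :
    wronskian u w x = wronskian u w y := by
  have hd : ∀ x, HasDerivAt (wronskian u w) 0 x := fun x =>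
    (((h x).1.mul (h' x).2).sub ((h x).2.mul (h' x).1)).congr_deriv (by ring)
  exact is_const_of_deriv_eq_zero (fun x => (hd x).differentiableAt) (fun x => (hd x).deriv) x y

/-- A bounded potential makes the system Lipschitz with constant ‖μ‖ + R uniformly in x, so
uniqueness for the Cauchy problem is global. -/
theorem IsSolution.eq_of_eq {R : ℝ} (hσ : σ = 1 ∨ σ = -1) (hR : ∀ x, |r x| ≤ R)
    (h : IsSolution σ r μ u) (h' : IsSolution σ r μ w) {x₀ : ℝ} (h0 : u x₀ = w x₀) : u = w := by
  have hR0 : 0 ≤ R := (abs_nonneg _).trans (hR 0)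
  refine ODE_solution_unique_univ (t₀ := x₀) (s := fun _ => univ) (K := (‖μ‖ + R).toNNReal)
    (v := fun x p => (-Complex.I * μ * p.1 - (σ : ℂ) * (r x : ℂ) * p.2,
      (r x : ℂ) * p.1 + Complex.I * μ * p.2)) (fun x => ?_)
    (fun x => ⟨(h x).1.prodMk (h x).2, mem_univ _⟩)
    (fun x => ⟨(h' x).1.prodMk (h' x).2, mem_univ _⟩) h0
  refine (LipschitzWith.of_dist_le_mul fun p q => ?_).lipschitzOnWith
  rw [Real.coe_toNNReal _ (by positivity), dist_eq_norm, dist_eq_norm]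
  have h1 : ‖p.1 - q.1‖ ≤ ‖p - q‖ := norm_fst_le (p - q)
  have h2 : ‖p.2 - q.2‖ ≤ ‖p - q‖ := norm_snd_le (p - q)
  have h0 := norm_nonneg (p - q)
  have hr1 : ∀ z : ℂ, ‖z‖ ≤ ‖p - q‖ → ‖(r x : ℂ) * z‖ ≤ R * ‖p - q‖ := fun z hz => by
    rw [norm_mul, Complex.norm_real, Real.norm_eq_abs]
    exact mul_le_mul (hR x) hz (norm_nonneg _) hR0
  have hm1 : ∀ z : ℂ, ‖z‖ ≤ ‖p - q‖ → ‖Complex.I * μ * z‖ ≤ ‖μ‖ * ‖p - q‖ := fun z hz => by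
    rw [norm_mul, norm_mul, Complex.norm_I, one_mul]
    exact mul_le_mul_of_nonneg_left hz (norm_nonneg _)
  refine norm_prod_le_iff.2 ⟨?_, ?_⟩
  · have : (-Complex.I * μ * p.1 - (σ : ℂ) * (r x : ℂ) * p.2) -
        (-Complex.I * μ * q.1 - (σ : ℂ) * (r x : ℂ) * q.2) =
        -(Complex.I * μ * (p.1 - q.1)) - σ * ((r x : ℂ) * (p.2 - q.2)) := by ring
    rw [Prod.fst_sub, this]
    refine (norm_sub_le _ _).trans ?_
    rw [norm_neg, norm_mul (σ : ℂ), norm_sign hσ, one_mul]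
    linarith [hm1 _ h1, hr1 _ h2]
  · have : ((r x : ℂ) * p.1 + Complex.I * μ * p.2) - ((r x : ℂ) * q.1 + Complex.I * μ * q.2) =
        Complex.I * μ * (p.2 - q.2) + (r x : ℂ) * (p.1 - q.1) := by ring
    rw [Prod.snd_sub, this]
    refine (norm_add_le _ _).trans ?_
    linarith [hm1 _ h2, hr1 _ h1]

theorem IsSolution.smul (h : IsSolution σ r μ u) (c : ℂ) : IsSolution σ r μ fun x => c • u x :=
  fun x => ⟨((h x).1.const_mul c).congr_deriv (by simp; ring),
    ((h x).2.const_mul c).congr_deriv (by simp; ring)⟩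

theorem isSolution_zero : IsSolution σ r μ fun _ => 0 := fun x =>
  ⟨(hasDerivAt_const x (0 : ℂ)).congr_deriv (by simp),
    (hasDerivAt_const x (0 : ℂ)).congr_deriv (by simp)⟩

theorem IsPsi.ne_zero {R : ℝ} (hσ : σ = 1 ∨ σ = -1) (hR : ∀ x, |r x| ≤ R)
    (h : IsPsi σ r μ u) (x : ℝ) : u x ≠ 0 := by
  intro hx
  have h0 := h.1.eq_of_eq hσ hR isSolution_zero hx
  have h1 := h.2
  rw [h0] at h1
  simp only [smul_zero] at h1
  have := tendsto_nhds_unique h1 tendsto_const_nhds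
  simp at this

/-- Two solutions with zero Wronskian are proportional. -/
theorem IsSolution.exists_eq_smul {R : ℝ} (hσ : σ = 1 ∨ σ = -1) (hR : ∀ x, |r x| ≤ R)
    (h : IsSolution σ r μ u) (h' : IsSolution σ r μ w) (hw : w 0 ≠ 0)
    (h0 : wronskian u w 0 = 0) : ∃ c : ℂ, ∀ x, u x = c • w x := by
  suffices ∃ c : ℂ, u 0 = c • w 0 by
    obtain ⟨c, hc⟩ := this
    exact ⟨c, fun x => congrFun (h.eq_of_eq hσ hR (h'.smul c) hc) x⟩
  rw [wronskian] at h0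
  by_cases h1 : (w 0).1 = 0
  · have h2 : (w 0).2 ≠ 0 := fun h2 => hw (Prod.ext h1 h2)
    refine ⟨(u 0).2 / (w 0).2, Prod.ext ?_ ?_⟩
    · rw [h1, mul_zero, sub_zero, mul_eq_zero, or_iff_left h2] at h0
      simp [h0, h1]
    · simp [h2]
  · refine ⟨(u 0).1 / (w 0).1, Prod.ext ?_ ?_⟩
    · simp [h1]
    · simp only [Prod.smul_snd, smul_eq_mul]
      field_simp
      linear_combination -h0

end Wronskian

end ZS

/-! ### Flows (r, S, C) and differentiability of Jost solutions in time. -/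

namespace ZS

theorem exists_bound_of_tendsto {f : ℝ → ℝ} {a b : ℝ} (hf : Continuous f)
    (ha : Tendsto f atBot (𝓝 a)) (hb : Tendsto f atTop (𝓝 b)) : ∃ M, ∀ x, |f x| ≤ M := by
  obtain ⟨A, hA⟩ := eventually_atBot.1 (ha.abs.eventually_le_const (lt_add_one |a|))
  obtain ⟨B, hB⟩ := eventually_atTop.1 (hb.abs.eventually_le_const (lt_add_one |b|))
  obtain ⟨D, hD⟩ := (isCompact_Icc (a := A) (b := B)).exists_bound_of_continuousOn hf.continuousOn
  refine ⟨max (max (|a| + 1) (|b| + 1)) D, fun x => ?_⟩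
  rcases le_total x A with h | h
  · exact (hA x h).trans ((le_max_left _ _).trans (le_max_left _ _))
  rcases le_total B x with h' | h'
  · exact (hB x h').trans ((le_max_right _ _).trans (le_max_left _ _))
  · exact (hD x ⟨h, h'⟩).trans (le_max_right _ _)

/-- The pair (v₁ - 1, v₂) vanishes at -∞ and solves the system with forcing (0, r), so the stability
estimate applies to it. -/
theorem IsModSolution.exists_bound {σ : ℝ} {r : ℝ → ℝ} {μ : ℂ} {v₁ v₂ : ℝ → ℂ}
    (hσ : σ = 1 ∨ σ = -1) (hμ : 0 ≤ μ.im) (hr : Continuous r) (hri : Integrable r)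
    (h : IsModSolution σ r μ (fun _ => 0) (fun _ => 0) v₁ v₂)
    (hv₁ : Tendsto v₁ atBot (𝓝 1)) (hv₂ : Tendsto v₂ atBot (𝓝 0)) :
    ∃ M, ∀ x, ‖v₁ x‖ ≤ M ∧ ‖v₂ x‖ ≤ M := by
  have hz : IsModSolution σ r μ (fun _ => 0) (fun x => (r x : ℂ)) (fun x => v₁ x - 1) v₂ :=
    fun x => ⟨(h x).1.sub_const 1, (h x).2.congr_deriv (by ring)⟩
  have hb := hz.norm_le hσ hμ hr hri (by simpa using hv₁.sub_const 1) hv₂ hr.abs hri.abs (by simp)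
  refine ⟨1 + Real.exp (∫ y, |r y|) * ∫ y, |r y|, fun x => ⟨?_, ?_⟩⟩
  · have := norm_add_le 1 (v₁ x - 1)
    rw [add_sub_cancel, norm_one] at this
    linarith [(hb x).1]
  · linarith [(hb x).2]

/-- A time-dependent potential `r` with `S = r_t` and a function `C` such that
`S_x = 2 r C`, `C_x = -2 σ r S`. -/
structure IsFlow (σ : ℝ) (r S C : ℝ → ℝ → ℝ) (Cm Cp : ℝ → ℝ) : Prop where
  cont : ∀ t, 0 ≤ t → Continuous fun x => r x t
  deriv_t : ∀ x t, 0 ≤ t → HasDerivWithinAt (fun s => r x s) (S x t) (Ici 0) t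
  dom : ∀ T : ℝ, ∃ g : ℝ → ℝ, Integrable g ∧
    ∀ x t, 0 ≤ t → t ≤ T → |r x t| ≤ g x ∧ |S x t| ≤ g x
  deriv_S : ∀ x t, 0 ≤ t → HasDerivAt (fun y => S y t) (2 * r x t * C x t) x
  deriv_C : ∀ x t, 0 ≤ t → HasDerivAt (fun y => C y t) (-2 * σ * r x t * S x t) x
  S_bot : ∀ t, 0 ≤ t → Tendsto (fun x => S x t) atBot (𝓝 0)
  S_top : ∀ t, 0 ≤ t → Tendsto (fun x => S x t) atTop (𝓝 0)
  C_bot : ∀ t, 0 ≤ t → Tendsto (fun x => C x t) atBot (𝓝 (Cm t))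
  C_top : ∀ t, 0 ≤ t → Tendsto (fun x => C x t) atTop (𝓝 (Cp t))

namespace IsFlow

variable {σ : ℝ} {r S C : ℝ → ℝ → ℝ} {Cm Cp : ℝ → ℝ} {t : ℝ} {μ : ℂ}

/-- Reversing x in S_x = 2rC forces the sign change of C, so the limits become -Cp at -∞ and -Cm at
+∞. This is why Cm enters the evolution of Φ with a minus sign and Cp that of Ψ with a plus sign. -/
theorem reflect (hσ : σ = 1 ∨ σ = -1) (h : IsFlow σ r S C Cm Cp) :
    IsFlow σ (fun x t => ZS.reflect σ (fun y => r y t) x)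
      (fun x t => ZS.reflect σ (fun y => S y t) x) (fun x t => -C (-x) t)
      (fun t => -Cp t) (fun t => -Cm t) where
  cont t ht := continuous_reflect (h.cont t ht)
  deriv_t x t ht := (h.deriv_t (-x) t ht).const_mul σ
  dom T := by
    obtain ⟨g, hg, hb⟩ := h.dom T
    refine ⟨fun x => g (-x), hg.comp_neg, fun x t h0 hT => ?_⟩
    have h1 : |σ| = 1 := by rcases hσ with rfl | rfl <;> simp
    simpa only [ZS.reflect, abs_mul, h1, one_mul] using hb (-x) t h0 hT
  deriv_S x t ht := by
    refine (((h.deriv_S (-x) t ht).scomp x (hasDerivAt_neg x)).const_mul σ).congr_deriv ?_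
    simp only [ZS.reflect, smul_eq_mul]
    ring
  deriv_C x t ht := by
    refine ((h.deriv_C (-x) t ht).scomp x (hasDerivAt_neg x)).neg.congr_deriv ?_
    simp only [ZS.reflect, smul_eq_mul]
    rcases hσ with rfl | rfl <;> ring
  S_bot t ht := by
    simpa [ZS.reflect] using ((h.S_top t ht).comp tendsto_neg_atBot_atTop).const_mul σ
  S_top t ht := by
    simpa [ZS.reflect] using ((h.S_bot t ht).comp tendsto_neg_atTop_atBot).const_mul σ
  C_bot t ht := ((h.C_top t ht).comp tendsto_neg_atBot_atTop).neg
  C_top t ht := ((h.C_bot t ht).comp tendsto_neg_atTop_atBot).neg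

theorem cont_S (h : IsFlow σ r S C Cm Cp) (ht : 0 ≤ t) : Continuous fun x => S x t :=
  continuous_iff_continuousAt.2 fun x => (h.deriv_S x t ht).continuousAt

theorem cont_C (h : IsFlow σ r S C Cm Cp) (ht : 0 ≤ t) : Continuous fun x => C x t :=
  continuous_iff_continuousAt.2 fun x => (h.deriv_C x t ht).continuousAt

theorem integrable (h : IsFlow σ r S C Cm Cp) (ht : 0 ≤ t) : Integrable fun x => r x t := by
  obtain ⟨g, hg, hb⟩ := h.dom t
  exact hg.mono' (h.cont t ht).aestronglyMeasurable
    (Eventually.of_forall fun x => (hb x t ht le_rfl).1)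

theorem integrable_S (h : IsFlow σ r S C Cm Cp) (ht : 0 ≤ t) : Integrable fun x => S x t := by
  obtain ⟨g, hg, hb⟩ := h.dom t
  exact hg.mono' (h.cont_S ht).aestronglyMeasurable
    (Eventually.of_forall fun x => (hb x t ht le_rfl).2)

/-- A bounded solution of the linearised modulated system that vanishes at `-∞` is the time
derivative of the modulated Jost solution. -/
theorem hasDerivWithinAt_of_linearized (h : IsFlow σ r S C Cm Cp) (hσ : σ = 1 ∨ σ = -1)
    (hμ : 0 ≤ μ.im) (ht : 0 ≤ t) {v₁ v₂ : ℝ → ℝ → ℂ}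
    (hv : ∀ s, 0 ≤ s →
      IsModSolution σ (fun x => r x s) μ (fun _ => 0) (fun _ => 0) (v₁ s) (v₂ s))
    (hv₁ : ∀ s, 0 ≤ s → Tendsto (v₁ s) atBot (𝓝 1))
    (hv₂ : ∀ s, 0 ≤ s → Tendsto (v₂ s) atBot (𝓝 0)) {k₁ k₂ : ℝ → ℂ} {M : ℝ}
    (hk : IsModSolution σ (fun x => r x t) μ (fun x => -(σ : ℂ) * S x t * v₂ t x)
      (fun x => S x t * v₁ t x) k₁ k₂)
    (hk₁ : Tendsto k₁ atBot (𝓝 0)) (hk₂ : Tendsto k₂ atBot (𝓝 0))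
    (hkM : ∀ x, ‖k₁ x‖ ≤ M ∧ ‖k₂ x‖ ≤ M) (hvM : ∀ x, ‖v₁ t x‖ ≤ M ∧ ‖v₂ t x‖ ≤ M) (x : ℝ) :
    HasDerivWithinAt (fun s => v₁ s x) (k₁ x) (Ici 0) t ∧
      HasDerivWithinAt (fun s => v₂ s x) (k₂ x) (Ici 0) t := by
  obtain ⟨g, hg, hb⟩ := h.dom (t + 1)
  have hM0 : 0 ≤ M := (norm_nonneg _).trans (hkM 0).1
  have htT : t ≤ t + 1 := by linarith
  have hev : ∀ᶠ s in 𝓝[Ici 0] t, s ∈ Icc 0 (t + 1) := by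
    filter_upwards [self_mem_nhdsWithin,
      mem_nhdsWithin_of_mem_nhds (Iio_mem_nhds (lt_add_one t))] with s h0 h1
    exact ⟨h0, h1.le⟩
  have hmvt : ∀ y, ∀ s ∈ Icc 0 (t + 1), |r y s - r y t| ≤ g y * |s - t| := fun y s hs =>
    (convex_Icc 0 (t + 1)).norm_image_sub_le_of_norm_hasDerivWithin_le
      (fun τ hτ => (h.deriv_t y τ hτ.1).mono fun _ hz => hz.1)
      (fun τ hτ => (hb y τ hτ.1 hτ.2).2) ⟨ht, htT⟩ hs
  -- The error of the difference quotient of r, equal to 0 at s = t by the convention 0⁻¹ = 0. It is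
  -- at most 2g by the mean value inequality and tends to 0 pointwise, so its integral tends to 0.
  set Y : ℝ → ℝ → ℝ := fun s y => ‖s - t‖⁻¹ * ‖r y s - r y t - (s - t) • S y t‖
  have hYm : ∀ s, ∀ y, ‖s - t‖ * Y s y = ‖r y s - r y t - (s - t) • S y t‖ := by
    intro s y
    by_cases hs : s = t
    · simp [hs]
    · exact mul_inv_cancel_left₀ (norm_ne_zero_iff.2 (sub_ne_zero.2 hs)) _
  have hYc : ∀ s ∈ Icc 0 (t + 1), Continuous (Y s) := fun s hs => by
    have h1 := h.cont s hs.1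
    have h2 := h.cont t ht
    have h3 := h.cont_S ht
    exact continuous_const.mul ((h1.sub h2).sub (h3.const_smul (s - t))).norm
  have hDc : ∀ s ∈ Icc 0 (t + 1), Continuous fun y => |r y s - r y t| := fun s hs =>
    ((h.cont s hs.1).sub (h.cont t ht)).abs
  have hY0 : ∀ s y, 0 ≤ Y s y := fun s y => by positivity
  have hg0 : ∀ y, 0 ≤ g y := fun y => (abs_nonneg _).trans (hb y t ht htT).1
  have hYb : ∀ s ∈ Icc 0 (t + 1), ∀ y, Y s y ≤ 2 * g y := by
    intro s hs y
    have h1 : ‖r y s - r y t - (s - t) • S y t‖ ≤ ‖s - t‖ * (2 * g y) := by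
      refine (norm_sub_le _ _).trans ?_
      rw [norm_smul, Real.norm_eq_abs, Real.norm_eq_abs, Real.norm_eq_abs]
      have := mul_le_mul_of_nonneg_left (hb y t ht htT).2 (abs_nonneg (s - t))
      linarith [hmvt y s hs]
    by_cases hs : s = t
    · simp only [Y, hs, sub_self, norm_zero, inv_zero, zero_mul]
      linarith [hg0 y]
    · exact (inv_mul_le_iff₀ (norm_pos_iff.2 (sub_ne_zero.2 hs))).2 h1
  have hDb : ∀ s ∈ Icc 0 (t + 1), ∀ y, |r y s - r y t| ≤ 2 * g y := fun s hs y =>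
    (abs_sub _ _).trans (by linarith [(hb y s hs.1 hs.2).1, (hb y t ht htT).1])
  have hYi : ∀ s ∈ Icc 0 (t + 1), Integrable (Y s) := fun s hs =>
    (hg.const_mul 2).mono' (hYc s hs).aestronglyMeasurable (Eventually.of_forall fun y => by
      rw [Real.norm_of_nonneg (hY0 s y)]
      exact hYb s hs y)
  have hDi : ∀ s ∈ Icc 0 (t + 1), Integrable fun y => |r y s - r y t| := fun s hs =>
    (hg.const_mul 2).mono' (hDc s hs).aestronglyMeasurable (Eventually.of_forall fun y => by
      rw [Real.norm_of_nonneg (abs_nonneg _)]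
      exact hDb s hs y)
  have hYl : Tendsto (fun s => ∫ y, Y s y) (𝓝[Ici 0] t) (𝓝 0) := by
    have := tendsto_integral_filter_of_dominated_convergence (μ := volume) (F := Y)
      (l := 𝓝[Ici 0] t) (f := fun _ => (0 : ℝ)) (fun y => 2 * g y)
      (hev.mono fun s hs => (hYc s hs).aestronglyMeasurable)
      (hev.mono fun s hs => Eventually.of_forall fun y => by
        rw [Real.norm_of_nonneg (hY0 s y)]
        exact hYb s hs y) (hg.const_mul 2)
      (Eventually.of_forall fun y => hasDerivWithinAt_iff_tendsto.1 (h.deriv_t y t ht))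
    simpa using this
  have hDl : Tendsto (fun s => ∫ y, |r y s - r y t|) (𝓝[Ici 0] t) (𝓝 0) := by
    have := tendsto_integral_filter_of_dominated_convergence (μ := volume)
      (F := fun s y => |r y s - r y t|)
      (l := 𝓝[Ici 0] t) (f := fun _ => (0 : ℝ)) (fun y => 2 * g y)
      (hev.mono fun s hs => (hDc s hs).aestronglyMeasurable)
      (hev.mono fun s hs => Eventually.of_forall fun y => by
        rw [Real.norm_of_nonneg (abs_nonneg _)]
        exact hDb s hs y) (hg.const_mul 2)
      (Eventually.of_forall fun y => by
        have := ((h.deriv_t y t ht).continuousWithinAt.sub_const (r y t)).abs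
        simpa [ContinuousWithinAt] using this)
    simpa using this
  set q : ℝ → ℝ := fun s =>
    Real.exp (∫ y, g y) * (2 * M * ((∫ y, Y s y) + ∫ y, |r y s - r y t|))
  have hq : Tendsto q (𝓝[Ici 0] t) (𝓝 0) := by
    simpa using ((hYl.add hDl).const_mul (2 * M)).const_mul (Real.exp (∫ y, g y))
  have main : ∀ s ∈ Icc 0 (t + 1),
      ‖v₁ t x + (s - t) * k₁ x - v₁ s x‖ ≤ ‖s - t‖ * q s ∧
      ‖v₂ t x + (s - t) * k₂ x - v₂ s x‖ ≤ ‖s - t‖ * q s := by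
    intro s hs
    set X : ℝ → ℝ := fun y => r y s - r y t - (s - t) • S y t
    -- The remainder v(t) + (s - t)k - v(s) solves the system with the potential at time s. Its
    -- forcing consists of the Taylor error of r times v(t) and (s - t)(r(s) - r(t)) times k, hence
    -- is |s - t| times something whose integral tends to 0.
    have hz : IsModSolution σ (fun x => r x s) μ
        (fun y => σ * ((X y : ℝ) * v₂ t y) + σ * ((s - t : ℝ) * ((r y s - r y t : ℝ) * k₂ y)))
        (fun y => -((X y : ℝ) * v₁ t y) - (s - t : ℝ) * ((r y s - r y t : ℝ) * k₁ y))
        (fun y => v₁ t y + (s - t) * k₁ y - v₁ s y)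
        (fun y => v₂ t y + (s - t) * k₂ y - v₂ s y) := by
      refine fun y => ⟨((((hv t ht y).1.add ((hk y).1.const_mul ((s : ℂ) - t))).sub
        (hv s hs.1 y).1)).congr_deriv ?_, ((((hv t ht y).2.add ((hk y).2.const_mul ((s : ℂ) - t))).sub
        (hv s hs.1 y).2)).congr_deriv ?_⟩
      · simp only [X, smul_eq_mul]
        push_cast
        ring
      · simp only [X, smul_eq_mul]
        push_cast
        ring
    have hX : ∀ y, ‖X y‖ = ‖s - t‖ * Y s y := fun y => (hYm s y).symm
    have hrn : ∀ (a : ℝ) (z : ℂ), ‖z‖ ≤ M → ‖(a : ℂ) * z‖ ≤ ‖a‖ * M := fun a z hz => by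
      rw [norm_mul, Complex.norm_real]
      exact mul_le_mul_of_nonneg_left hz (norm_nonneg _)
    have hrn2 : ∀ (a b : ℝ) (z : ℂ), ‖z‖ ≤ M → ‖(a : ℂ) * ((b : ℂ) * z)‖ ≤ ‖a‖ * (‖b‖ * M) :=
      fun a b z hz => by
        rw [norm_mul, Complex.norm_real]
        exact mul_le_mul_of_nonneg_left (hrn b z hz) (norm_nonneg _)
    have hcz : Tendsto (fun y => v₁ t y + (s - t) * k₁ y - v₁ s y) atBot (𝓝 0) := by
      simpa using ((hv₁ t ht).add (hk₁.const_mul ((s : ℂ) - t))).sub (hv₁ s hs.1)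
    have hcz' : Tendsto (fun y => v₂ t y + (s - t) * k₂ y - v₂ s y) atBot (𝓝 0) := by
      simpa using ((hv₂ t ht).add (hk₂.const_mul ((s : ℂ) - t))).sub (hv₂ s hs.1)
    have hle := hz.norm_le hσ hμ (h.cont s hs.1) (h.integrable hs.1) hcz hcz'
      (e := fun y => ‖s - t‖ * (2 * M * (Y s y + |r y s - r y t|)))
      (continuous_const.mul (continuous_const.mul ((hYc s hs).add (hDc s hs))))
      ((((hYi s hs).add (hDi s hs)).const_mul _).const_mul _) (fun y => by
        have h1 : ‖(σ : ℂ) * ((X y : ℝ) * v₂ t y) +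
            σ * ((s - t : ℝ) * ((r y s - r y t : ℝ) * k₂ y))‖ ≤
            ‖X y‖ * M + ‖s - t‖ * (‖r y s - r y t‖ * M) := by
          refine (norm_add_le _ _).trans ?_
          rw [norm_mul (σ : ℂ), norm_mul (σ : ℂ), norm_sign hσ, one_mul, one_mul]
          exact add_le_add (hrn _ _ (hvM y).2) (hrn2 _ _ _ (hkM y).2)
        have h2 : ‖-((X y : ℝ) * v₁ t y) - (s - t : ℝ) * ((r y s - r y t : ℝ) * k₁ y)‖ ≤
            ‖X y‖ * M + ‖s - t‖ * (‖r y s - r y t‖ * M) := by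
          refine (norm_sub_le _ _).trans ?_
          rw [norm_neg]
          exact add_le_add (hrn _ _ (hvM y).1) (hrn2 _ _ _ (hkM y).1)
        rw [hX] at h1 h2
        rw [Real.norm_eq_abs (r y s - r y t)] at h1 h2
        linarith) x
    have hexp : Real.exp (∫ y, |r y s|) ≤ Real.exp (∫ y, g y) :=
      Real.exp_le_exp.2 (integral_mono (h.integrable hs.1).abs hg fun y => (hb y s hs.1 hs.2).1)
    have hint : ∫ y, ‖s - t‖ * (2 * M * (Y s y + |r y s - r y t|)) =
        ‖s - t‖ * (2 * M * ((∫ y, Y s y) + ∫ y, |r y s - r y t|)) := by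
      rw [integral_const_mul, integral_const_mul, integral_add (hYi s hs) (hDi s hs)]
    have hfin : Real.exp (∫ y, |r y s|) *
        ∫ y, ‖s - t‖ * (2 * M * (Y s y + |r y s - r y t|)) ≤ ‖s - t‖ * q s := by
      rw [hint]
      have h0 : 0 ≤ ‖s - t‖ * (2 * M * ((∫ y, Y s y) + ∫ y, |r y s - r y t|)) :=
        mul_nonneg (norm_nonneg _) (mul_nonneg (by linarith)
          (add_nonneg (integral_nonneg (hY0 s)) (integral_nonneg fun _ => abs_nonneg _)))
      refine (mul_le_mul_of_nonneg_right hexp h0).trans_eq ?_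
      simp only [q]
      ring
    exact ⟨hle.1.trans hfin, hle.2.trans hfin⟩
  have conclude : ∀ (f : ℝ → ℂ) (c : ℂ),
      (∀ s ∈ Icc 0 (t + 1), ‖f t + (s - t) * c - f s‖ ≤ ‖s - t‖ * q s) →
      HasDerivWithinAt f c (Ici 0) t := by
    intro f c hf
    rw [hasDerivWithinAt_iff_tendsto]
    have hqa : Tendsto (fun s => |q s|) (𝓝[Ici 0] t) (𝓝 0) := by simpa using hq.abs
    refine squeeze_zero' (Eventually.of_forall fun s => by positivity) (hev.mono fun s hs => ?_) hqa
    have h1 : ‖f s - f t - (s - t) • c‖ ≤ ‖s - t‖ * q s := by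
      rw [← norm_neg]
      refine le_of_eq_of_le (congrArg _ ?_) (hf s hs)
      rw [Complex.real_smul]
      push_cast
      ring
    by_cases hst : s = t
    · simp [hst]
    · rw [inv_mul_le_iff₀ (norm_pos_iff.2 (sub_ne_zero.2 hst))]
      exact h1.trans (mul_le_mul_of_nonneg_left (le_abs_self _) (norm_nonneg _))
  exact ⟨conclude _ _ fun s hs => (main s hs).1, conclude _ _ fun s hs => (main s hs).2⟩

end IsFlow

end ZS

/-! ### Time evolution of Φ and Ψ. -/

namespace ZS
namespace IsFlow

variable {σ : ℝ} {r S C : ℝ → ℝ → ℝ} {Cm Cp : ℝ → ℝ} {t : ℝ} {μ : ℂ}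

theorem exists_bound_S (h : IsFlow σ r S C Cm Cp) (ht : 0 ≤ t) : ∃ M, ∀ x, |S x t| ≤ M :=
  exists_bound_of_tendsto (h.cont_S ht) (h.S_bot t ht) (h.S_top t ht)

theorem exists_bound_C (h : IsFlow σ r S C Cm Cp) (ht : 0 ≤ t) : ∃ M, ∀ x, |C x t| ≤ M :=
  exists_bound_of_tendsto (h.cont_C ht) (h.C_bot t ht) (h.C_top t ht)

/-- The matrix `(C, σS; S, -C) - Cm` maps solutions of the modulated system to solutions of an
inhomogeneous one. -/
theorem isModSolution_dressed (h : IsFlow σ r S C Cm Cp) (ht : 0 ≤ t)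
    {v₁ v₂ : ℝ → ℂ} (hv : IsModSolution σ (fun x => r x t) μ (fun _ => 0) (fun _ => 0) v₁ v₂) :
    IsModSolution σ (fun x => r x t) μ
      (fun x => 2 * Complex.I * μ * (σ * S x t * v₂ x))
      (fun x => -(2 * Complex.I * μ * (S x t * v₁ x)))
      (fun x => ((C x t : ℂ) - Cm t) * v₁ x + σ * (S x t * v₂ x))
      (fun x => S x t * v₁ x - ((C x t : ℂ) + Cm t) * v₂ x) := by
  intro x
  have hS := (h.deriv_S x t ht).ofReal_comp
  have hC := (h.deriv_C x t ht).ofReal_comp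
  -- As M_x = [Q, M], only the commutator of M with diag(0, 2iμ) survives; it is 2iμ (0, σS; -S, 0).
  refine ⟨(((hC.sub_const _).mul (hv x).1).add ((hS.mul (hv x).2).const_mul (σ : ℂ))).congr_deriv ?_,
    ((hS.mul (hv x).1).sub ((hC.add_const _).mul (hv x).2)).congr_deriv ?_⟩
  · push_cast
    ring
  · push_cast
    ring

theorem tendsto_dressed (h : IsFlow σ r S C Cm Cp) (ht : 0 ≤ t) {v₁ v₂ : ℝ → ℂ}
    (hv₁ : Tendsto v₁ atBot (𝓝 1)) (hv₂ : Tendsto v₂ atBot (𝓝 0)) :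
    Tendsto (fun x => ((C x t : ℂ) - Cm t) * v₁ x + σ * (S x t * v₂ x)) atBot (𝓝 0) ∧
      Tendsto (fun x => S x t * v₁ x - ((C x t : ℂ) + Cm t) * v₂ x) atBot (𝓝 0) := by
  have hS : Tendsto (fun x => (S x t : ℂ)) atBot (𝓝 (0 : ℝ)) :=
    (Complex.continuous_ofReal.tendsto _).comp (h.S_bot t ht)
  have hC : Tendsto (fun x => (C x t : ℂ)) atBot (𝓝 (Cm t)) :=
    (Complex.continuous_ofReal.tendsto _).comp (h.C_bot t ht)
  rw [Complex.ofReal_zero] at hS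
  constructor
  · simpa using ((hC.sub_const (Cm t : ℂ)).mul hv₁).add ((hS.mul hv₂).const_mul (σ : ℂ))
  · simpa using (hS.mul hv₁).sub ((hC.add_const (Cm t : ℂ)).mul hv₂)

theorem isPhi (h : IsFlow σ r S C Cm Cp) (hσ : σ = 1 ∨ σ = -1) (hμ : 0 ≤ μ.im) (ht : 0 ≤ t) :
    IsPhi σ (fun x => r x t) μ (phi σ (fun x => r x t) μ) :=
  isPhi_phi hσ hμ (h.cont t ht) (h.integrable ht)

theorem isPsi (h : IsFlow σ r S C Cm Cp) (hσ : σ = 1 ∨ σ = -1) (hμ : 0 ≤ μ.im) (ht : 0 ≤ t) :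
    IsPsi σ (fun x => r x t) μ (psi σ (fun x => r x t) μ) :=
  isPsi_psi hσ hμ (h.cont t ht) (h.integrable ht)

theorem norm_ofReal_mul_le {a A M : ℝ} {z : ℂ} (ha : |a| ≤ A) (hz : ‖z‖ ≤ M) :
    ‖(a : ℂ) * z‖ ≤ A * M := by
  rw [norm_mul, Complex.norm_real, Real.norm_eq_abs]
  exact mul_le_mul ha hz (norm_nonneg _) ((abs_nonneg _).trans ha)

theorem phi_hasDerivWithinAt_of_linearized (h : IsFlow σ r S C Cm Cp) (hσ : σ = 1 ∨ σ = -1)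
    (hμ : 0 ≤ μ.im) (ht : 0 ≤ t) {k₁ k₂ : ℝ → ℂ} {M : ℝ}
    (hk : IsModSolution σ (fun x => r x t) μ
      (fun x => -(σ : ℂ) * S x t *
        (Complex.exp (Complex.I * μ * x) * (phi σ (fun x => r x t) μ x).2))
      (fun x => S x t * (Complex.exp (Complex.I * μ * x) * (phi σ (fun x => r x t) μ x).1)) k₁ k₂)
    (hk₁ : Tendsto k₁ atBot (𝓝 0)) (hk₂ : Tendsto k₂ atBot (𝓝 0))
    (hkM : ∀ x, ‖k₁ x‖ ≤ M ∧ ‖k₂ x‖ ≤ M) :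
    HasDerivWithinAt (fun s => (phi σ (fun x => r x s) μ 0).1) (k₁ 0) (Ici 0) t ∧
      HasDerivWithinAt (fun s => (phi σ (fun x => r x s) μ 0).2) (k₂ 0) (Ici 0) t := by
  have hp := h.isPhi hσ hμ ht
  obtain ⟨N, hN⟩ := hp.1.isModSolution.exists_bound hσ hμ (h.cont t ht) (h.integrable ht)
    hp.tendsto_fst hp.tendsto_snd
  have := h.hasDerivWithinAt_of_linearized hσ hμ ht (M := max M N)
    (v₁ := fun s x => Complex.exp (Complex.I * μ * x) * (phi σ (fun x => r x s) μ x).1)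
    (v₂ := fun s x => Complex.exp (Complex.I * μ * x) * (phi σ (fun x => r x s) μ x).2)
    (fun s hs => (h.isPhi hσ hμ hs).1.isModSolution)
    (fun s hs => (h.isPhi hσ hμ hs).tendsto_fst) (fun s hs => (h.isPhi hσ hμ hs).tendsto_snd)
    hk hk₁ hk₂ (fun x => ⟨(hkM x).1.trans (le_max_left _ _), (hkM x).2.trans (le_max_left _ _)⟩)
    (fun x => ⟨(hN x).1.trans (le_max_right _ _), (hN x).2.trans (le_max_right _ _)⟩) 0
  simpa using this

/-- Time evolution of `Φ` at `x = 0` for `μ ≠ 0`. -/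
theorem phi_hasDerivWithinAt (h : IsFlow σ r S C Cm Cp) (hσ : σ = 1 ∨ σ = -1)
    (hμ : 0 ≤ μ.im) (hμ0 : μ ≠ 0) (ht : 0 ≤ t) :
    HasDerivWithinAt (fun s => (phi σ (fun x => r x s) μ 0).1)
      (Complex.I / (2 * μ) * (((C 0 t : ℂ) - Cm t) * (phi σ (fun x => r x t) μ 0).1 +
        σ * (S 0 t * (phi σ (fun x => r x t) μ 0).2))) (Ici 0) t ∧
    HasDerivWithinAt (fun s => (phi σ (fun x => r x s) μ 0).2)
      (Complex.I / (2 * μ) * (S 0 t * (phi σ (fun x => r x t) μ 0).1 -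
        ((C 0 t : ℂ) + Cm t) * (phi σ (fun x => r x t) μ 0).2)) (Ici 0) t := by
  have hp := h.isPhi hσ hμ ht
  set v₁ : ℝ → ℂ := fun x => Complex.exp (Complex.I * μ * x) * (phi σ (fun x => r x t) μ x).1
    with hv₁
  set v₂ : ℝ → ℂ := fun x => Complex.exp (Complex.I * μ * x) * (phi σ (fun x => r x t) μ x).2
    with hv₂
  obtain ⟨N, hN⟩ := hp.1.isModSolution.exists_bound hσ hμ (h.cont t ht) (h.integrable ht)
    hp.tendsto_fst hp.tendsto_snd
  obtain ⟨A, hA⟩ := h.exists_bound_S ht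
  obtain ⟨B, hB⟩ := h.exists_bound_C ht
  have hd := h.isModSolution_dressed ht hp.1.isModSolution
  have hl := h.tendsto_dressed ht hp.tendsto_fst hp.tendsto_snd
  set c : ℂ := Complex.I / (2 * μ)
  -- With this constant, the forcing of the dressed pair becomes that of the linearised system.
  have hc : c * (2 * Complex.I * μ) = -1 := by
    simp only [c]
    field_simp
    exact Complex.I_sq
  have hBm : ∀ x, |C x t - Cm t| ≤ B + |Cm t| := fun x => (abs_sub _ _).trans (by gcongr; exact hB x)
  have hBp : ∀ x, |C x t + Cm t| ≤ B + |Cm t| := fun x =>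
    (abs_add_le _ _).trans (by gcongr; exact hB x)
  have hk1 : ∀ x, ‖((C x t : ℂ) - Cm t) * v₁ x + σ * (S x t * v₂ x)‖ ≤ (B + |Cm t|) * N + A * N := by
    intro x
    refine (norm_add_le _ _).trans (add_le_add ?_ ?_)
    · rw [← Complex.ofReal_sub]
      exact norm_ofReal_mul_le (hBm x) (hN x).1
    · rw [norm_mul, norm_sign hσ, one_mul]
      exact norm_ofReal_mul_le (hA x) (hN x).2
  have hk2 : ∀ x, ‖S x t * v₁ x - ((C x t : ℂ) + Cm t) * v₂ x‖ ≤ (B + |Cm t|) * N + A * N := by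
    intro x
    rw [add_comm ((B + |Cm t|) * N)]
    refine (norm_sub_le _ _).trans (add_le_add (norm_ofReal_mul_le (hA x) (hN x).1) ?_)
    rw [← Complex.ofReal_add]
    exact norm_ofReal_mul_le (hBp x) (hN x).2
  have := h.phi_hasDerivWithinAt_of_linearized hσ hμ ht
    (k₁ := fun x => c * (((C x t : ℂ) - Cm t) * v₁ x + σ * (S x t * v₂ x)))
    (k₂ := fun x => c * (S x t * v₁ x - ((C x t : ℂ) + Cm t) * v₂ x))
    (M := ‖c‖ * ((B + |Cm t|) * N + A * N))
    (fun x => ⟨((hd x).1.const_mul c).congr_deriv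
        (by linear_combination (σ * S x t * v₂ x : ℂ) * hc),
      ((hd x).2.const_mul c).congr_deriv (by linear_combination -(S x t * v₁ x : ℂ) * hc)⟩)
    (by simpa using hl.1.const_mul c) (by simpa using hl.2.const_mul c)
    (fun x => ⟨by
      rw [norm_mul]
      exact mul_le_mul_of_nonneg_left (hk1 x) (norm_nonneg _), by
      rw [norm_mul]
      exact mul_le_mul_of_nonneg_left (hk2 x) (norm_nonneg _)⟩)
  simpa [hv₁, hv₂] using this

/-- Time evolution of `Φ` at `x = 0` for `μ = 0`. -/
theorem phi_zero_hasDerivWithinAt (h : IsFlow σ r S C Cm Cp) (hσ : σ = 1 ∨ σ = -1) (ht : 0 ≤ t) :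
    HasDerivWithinAt (fun s => (phi σ (fun x => r x s) 0 0).1)
      (-σ * ((∫ y in Iic 0, S y t : ℝ) * (phi σ (fun x => r x t) 0 0).2)) (Ici 0) t ∧
    HasDerivWithinAt (fun s => (phi σ (fun x => r x s) 0 0).2)
      ((∫ y in Iic 0, S y t : ℝ) * (phi σ (fun x => r x t) 0 0).1) (Ici 0) t := by
  have hμ : 0 ≤ (0 : ℂ).im := le_rfl
  have hp := h.isPhi hσ hμ ht
  have hv := hp.1.isModSolution
  obtain ⟨N, hN⟩ := hv.exists_bound hσ hμ (h.cont t ht) (h.integrable ht)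
    hp.tendsto_fst hp.tendsto_snd
  set v₁ : ℝ → ℂ := fun x => Complex.exp (Complex.I * 0 * x) * (phi σ (fun x => r x t) 0 x).1
    with hv₁
  set v₂ : ℝ → ℂ := fun x => Complex.exp (Complex.I * 0 * x) * (phi σ (fun x => r x t) 0 x).2
    with hv₂
  have hl₁ : Tendsto v₁ atBot (𝓝 1) := hp.tendsto_fst
  have hl₂ : Tendsto v₂ atBot (𝓝 0) := hp.tendsto_snd
  set L : ℝ → ℝ := fun x => ∫ y in Iic x, S y t
  have hL : ∀ x, HasDerivAt (fun x => (L x : ℂ)) (S x t : ℝ) x := fun x =>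
    (hasDerivAt_integral_Iic (h.cont_S ht) (fun _ => (h.integrable_S ht).integrableOn) x).ofReal_comp
  have hL0 : Tendsto (fun x => (L x : ℂ)) atBot (𝓝 (0 : ℝ)) :=
    (Complex.continuous_ofReal.tendsto _).comp (tendsto_integral_Iic_zero tendsto_id)
  rw [Complex.ofReal_zero] at hL0
  have hLb : ∀ x, |L x| ≤ ∫ y, |S y t| := fun x =>
    (abs_integral_le_integral_abs).trans (setIntegral_le_integral (h.integrable_S ht).abs
      (Eventually.of_forall fun _ => abs_nonneg _))
  -- At μ = 0 the coefficient matrix is rJ with J = (0, -σ; 1, 0) constant, so LJv with L = ∫_{-∞}^x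
  -- S solves the linearised system.
  have := h.phi_hasDerivWithinAt_of_linearized hσ hμ ht
    (k₁ := fun x => -σ * (L x * v₂ x)) (k₂ := fun x => L x * v₁ x)
    (M := (∫ y, |S y t|) * N)
    (fun x => ⟨(((hL x).mul (hv x).2).const_mul (-σ : ℂ)).congr_deriv (by simp only [hv₁, hv₂]; ring),
      ((hL x).mul (hv x).1).congr_deriv (by simp only [hv₁, hv₂]; ring)⟩)
    (by simpa using (hL0.mul hl₂).const_mul (-σ : ℂ)) (by simpa using hL0.mul hl₁)
    (fun x => ⟨by
      rw [norm_mul, norm_neg, norm_sign hσ, one_mul]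
      exact norm_ofReal_mul_le (hLb x) (hN x).2, norm_ofReal_mul_le (hLb x) (hN x).1⟩)
  simpa [hv₁, hv₂] using this

/-- At `μ = 0`, `Φ` is an eigenvector of `(C, σS; S, -C)`. -/
theorem phi_zero_eigenvector (h : IsFlow σ r S C Cm Cp) (hσ : σ = 1 ∨ σ = -1) (ht : 0 ≤ t) :
    ((C 0 t : ℂ) - Cm t) * (phi σ (fun x => r x t) 0 0).1 +
        σ * (S 0 t * (phi σ (fun x => r x t) 0 0).2) = 0 ∧
      S 0 t * (phi σ (fun x => r x t) 0 0).1 -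
        ((C 0 t : ℂ) + Cm t) * (phi σ (fun x => r x t) 0 0).2 = 0 := by
  have hμ : 0 ≤ (0 : ℂ).im := le_rfl
  have hp := h.isPhi hσ hμ ht
  have hd := h.isModSolution_dressed ht hp.1.isModSolution
  -- The forcing carries a factor μ, so (M - Cm)v is a solution of the homogeneous system vanishing
  -- at -∞.
  simp only [mul_zero, zero_mul, neg_zero] at hd
  have hl := h.tendsto_dressed ht hp.tendsto_fst hp.tendsto_snd
  simp only [mul_zero, zero_mul] at hl
  simpa using hd.eq_zero hσ hμ (h.cont t ht) (h.integrable ht) hl.1 hl.2 0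

theorem phi_reflect_zero (h : IsFlow σ r S C Cm Cp) (hσ : σ = 1 ∨ σ = -1) (hμ : 0 ≤ μ.im)
    (ht : 0 ≤ t) : phi σ (fun x => ZS.reflect σ (fun y => r y t) x) μ 0 =
      (psi σ (fun x => r x t) μ 0).swap := by
  have := swap_psi hσ hμ (h.cont t ht) (h.integrable ht) 0
  rw [neg_zero] at this
  exact this.symm

theorem psi_congr (h : IsFlow σ r S C Cm Cp) (hσ : σ = 1 ∨ σ = -1) (hμ : 0 ≤ μ.im) (ht : 0 ≤ t)
    {c₁ c₂ : ℂ}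
    (hd : HasDerivWithinAt
      (fun s => (phi σ (fun x => ZS.reflect σ (fun y => r y s) x) μ 0).1) c₁ (Ici 0) t ∧
      HasDerivWithinAt
      (fun s => (phi σ (fun x => ZS.reflect σ (fun y => r y s) x) μ 0).2) c₂ (Ici 0) t) :
    HasDerivWithinAt (fun s => (psi σ (fun x => r x s) μ 0).1) c₂ (Ici 0) t ∧
      HasDerivWithinAt (fun s => (psi σ (fun x => r x s) μ 0).2) c₁ (Ici 0) t :=
  ⟨hd.2.congr_of_mem (fun s hs => by rw [h.phi_reflect_zero hσ hμ hs, Prod.snd_swap]) ht,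
    hd.1.congr_of_mem (fun s hs => by rw [h.phi_reflect_zero hσ hμ hs, Prod.fst_swap]) ht⟩

/-- Time evolution of `Ψ` at `x = 0` for `μ ≠ 0`. -/
theorem psi_hasDerivWithinAt (h : IsFlow σ r S C Cm Cp) (hσ : σ = 1 ∨ σ = -1)
    (hμ : 0 ≤ μ.im) (hμ0 : μ ≠ 0) (ht : 0 ≤ t) :
    HasDerivWithinAt (fun s => (psi σ (fun x => r x s) μ 0).1)
      (Complex.I / (2 * μ) * (((C 0 t : ℂ) + Cp t) * (psi σ (fun x => r x t) μ 0).1 +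
        σ * (S 0 t * (psi σ (fun x => r x t) μ 0).2))) (Ici 0) t ∧
    HasDerivWithinAt (fun s => (psi σ (fun x => r x s) μ 0).2)
      (Complex.I / (2 * μ) * (S 0 t * (psi σ (fun x => r x t) μ 0).1 +
        ((Cp t : ℂ) - C 0 t) * (psi σ (fun x => r x t) μ 0).2)) (Ici 0) t := by
  have hσσ := sign_mul_self hσ
  obtain ⟨h1, h2⟩ := h.psi_congr hσ hμ ht ((h.reflect hσ).phi_hasDerivWithinAt hσ hμ hμ0 ht)
  rw [h.phi_reflect_zero hσ hμ ht] at h1 h2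
  refine ⟨h1.congr_deriv ?_, h2.congr_deriv ?_⟩
  · simp only [ZS.reflect, neg_zero, Prod.fst_swap, Prod.snd_swap]
    push_cast
    ring
  · simp only [ZS.reflect, neg_zero, Prod.fst_swap, Prod.snd_swap]
    push_cast
    linear_combination (Complex.I / (2 * μ) * S 0 t * (psi σ (fun x => r x t) μ 0).1) * hσσ

/-- Time evolution of `Ψ` at `x = 0` for `μ = 0`. -/
theorem psi_zero_hasDerivWithinAt (h : IsFlow σ r S C Cm Cp) (hσ : σ = 1 ∨ σ = -1) (ht : 0 ≤ t) :
    ∃ l : ℂ, HasDerivWithinAt (fun s => (psi σ (fun x => r x s) 0 0).1)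
      (σ * (l * (psi σ (fun x => r x t) 0 0).2)) (Ici 0) t ∧
    HasDerivWithinAt (fun s => (psi σ (fun x => r x s) 0 0).2)
      (-(l * (psi σ (fun x => r x t) 0 0).1)) (Ici 0) t := by
  have hσσ := sign_mul_self hσ
  have hμ : 0 ≤ (0 : ℂ).im := le_rfl
  obtain ⟨h1, h2⟩ := h.psi_congr hσ hμ ht ((h.reflect hσ).phi_zero_hasDerivWithinAt hσ ht)
  rw [h.phi_reflect_zero hσ hμ ht] at h1 h2
  set l : ℂ := ((∫ y in Iic 0, ZS.reflect σ (fun y => S y t) y : ℝ) : ℂ)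
  refine ⟨σ * l, h1.congr_deriv ?_, h2.congr_deriv ?_⟩
  · rw [Prod.fst_swap]
    linear_combination (-l * (psi σ (fun x => r x t) 0 0).2) * hσσ
  · rw [Prod.snd_swap]
    ring

/-- Reflection of `phi_zero_eigenvector`: the eigenvalue of M is now -Cp. -/
theorem psi_zero_eigenvector (h : IsFlow σ r S C Cm Cp) (hσ : σ = 1 ∨ σ = -1) (ht : 0 ≤ t) :
    ((C 0 t : ℂ) + Cp t) * (psi σ (fun x => r x t) 0 0).1 +
        σ * (S 0 t * (psi σ (fun x => r x t) 0 0).2) = 0 ∧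
      S 0 t * (psi σ (fun x => r x t) 0 0).1 +
        ((Cp t : ℂ) - C 0 t) * (psi σ (fun x => r x t) 0 0).2 = 0 := by
  have hσσ := sign_mul_self hσ
  have := (h.reflect hσ).phi_zero_eigenvector hσ ht
  rw [h.phi_reflect_zero hσ le_rfl ht] at this
  simp only [ZS.reflect, neg_zero, Prod.fst_swap, Prod.snd_swap] at this
  push_cast at this
  constructor
  · linear_combination this.2
  · linear_combination this.1 - (S 0 t * (psi σ (fun x => r x t) 0 0).1) * hσσ

end IsFlow
end ZS

namespace ZS

/-! ### From the evolution equation to a flow. -/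

section Setup

variable {σ : ℝ} {r : ℝ → ℝ → ℝ}

theorem IsRegular.continuous_r (h : IsRegular r) {t : ℝ} (ht : 0 ≤ t) :
    Continuous fun x => r x t :=
  h.cont.comp_continuous (f := fun x => (x, t)) (by fun_prop) fun _ => ⟨mem_univ _, ht⟩

theorem IsRegular.continuous_timeDeriv (h : IsRegular r) {t : ℝ} (ht : 0 ≤ t) :
    Continuous fun x => timeDeriv r x t :=
  h.cont_timeDeriv.comp_continuous (f := fun x => (x, t)) (by fun_prop) fun _ => ⟨mem_univ _, ht⟩

theorem IsRegular.hasDerivWithinAt (h : IsRegular r) (x : ℝ) {t : ℝ} (ht : 0 ≤ t) :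
    HasDerivWithinAt (fun s => r x s) (timeDeriv r x t) (Ici 0) t :=
  (h.diff x t ht).hasDerivWithinAt

theorem IsRegular.timeDeriv_sq (h : IsRegular r) (x : ℝ) {t : ℝ} (ht : 0 ≤ t) :
    timeDeriv (fun z s => r z s ^ 2) x t = 2 * r x t * timeDeriv r x t := by
  have : HasDerivWithinAt (fun s => r x s ^ 2) (2 * r x t * timeDeriv r x t) (Ici 0) t :=
    ((h.hasDerivWithinAt x ht).pow 2).congr_deriv (by simp)
  exact this.derivWithin (uniqueDiffOn_Ici 0 t ht)

/-- The dominating function may be unbounded on compact sets. It is used only near infinity, where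
it is at most 1; elsewhere joint continuity of r bounds it. -/
theorem exists_bound_of_decays (hreg : IsRegular r) (hdecay : Decays r) (T : ℝ) :
    ∃ R, ∀ x t, 0 ≤ t → t ≤ T → |r x t| ≤ R := by
  obtain ⟨g, -, hg, hb⟩ := hdecay T
  obtain ⟨K, hK, hKg⟩ := (hasBasis_cocompact.eventually_iff).1
    (hg.eventually_le_const (zero_lt_one (α := ℝ)))
  obtain ⟨D, hD⟩ := (hK.prod (isCompact_Icc (a := (0 : ℝ)) (b := T))).exists_bound_of_continuousOn
    (hreg.cont.mono (prod_mono (subset_univ K) fun _ h => h.1))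
  refine ⟨max 1 D, fun x t h0 hT => ?_⟩
  by_cases hx : x ∈ K
  · exact (hD (x, t) ⟨hx, h0, hT⟩).trans (le_max_right _ _)
  · exact ((hb x t h0 hT).1.trans (hKg hx)).trans (le_max_left _ _)

theorem Decays.tendsto_timeDeriv (hdecay : Decays r) {t : ℝ} (ht : 0 ≤ t) :
    Tendsto (fun x => timeDeriv r x t) (cocompact ℝ) (𝓝 0) := by
  obtain ⟨g, -, hg, hb⟩ := hdecay t
  exact squeeze_zero_norm (fun x => (hb x t ht le_rfl).2) hg

theorem integrable_timeDeriv_sq (hreg : IsRegular r) (hdecay : Decays r) {t : ℝ} (ht : 0 ≤ t) :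
    Integrable fun x => timeDeriv (fun z s => r z s ^ 2) x t := by
  obtain ⟨R, hR⟩ := exists_bound_of_decays hreg hdecay t
  obtain ⟨g, hg, -, hb⟩ := hdecay t
  have hS : Integrable fun x => timeDeriv r x t :=
    hg.mono' (hreg.continuous_timeDeriv ht).aestronglyMeasurable
      (Eventually.of_forall fun x => (hb x t ht le_rfl).2)
  simp only [hreg.timeDeriv_sq _ ht, mul_assoc]
  exact (hS.bdd_mul (hreg.continuous_r ht).aestronglyMeasurable
    (Eventually.of_forall fun x => hR x t ht le_rfl)).const_mul 2

/-- The constant 1/2 turns the right side of the equation into 2rC. The limit of C at -∞ still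
contains the total integral of (r²)_t. -/
theorem isFlow (hreg : IsRegular r) (hdecay : Decays r) (heq : SolvesEquation σ r) :
    IsFlow σ r (timeDeriv r)
      (fun x t => 1 / 2 + σ * ∫ y in Ioi x, timeDeriv (fun z s => r z s ^ 2) y t)
      (fun t => 1 / 2 + σ * ∫ y, timeDeriv (fun z s => r z s ^ 2) y t) (fun _ => 1 / 2) where
  cont t ht := hreg.continuous_r ht
  deriv_t x t ht := hreg.hasDerivWithinAt x ht
  dom T := by
    obtain ⟨g, hg, -, hb⟩ := hdecay T
    exact ⟨g, hg, hb⟩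
  deriv_S x t ht := (heq x t ht).congr_deriv (by ring)
  deriv_C x t ht := by
    have hi := integrable_timeDeriv_sq hreg hdecay ht
    have hc : Continuous fun y => timeDeriv (fun z s => r z s ^ 2) y t := by
      simp only [hreg.timeDeriv_sq _ ht]
      exact (continuous_const.mul (hreg.continuous_r ht)).mul (hreg.continuous_timeDeriv ht)
    have hsplit : ∀ x, ∫ y in Ioi x, timeDeriv (fun z s => r z s ^ 2) y t =
        (∫ y, timeDeriv (fun z s => r z s ^ 2) y t) -
          ∫ y in Iic x, timeDeriv (fun z s => r z s ^ 2) y t := fun x => by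
      rw [← intervalIntegral.integral_Iic_add_Ioi (b := x) hi.integrableOn hi.integrableOn]
      ring
    simp only [hsplit]
    refine ((((hasDerivAt_integral_Iic hc (fun _ => hi.integrableOn) x).const_sub _).const_mul
      σ).const_add (1 / 2)).congr_deriv ?_
    rw [hreg.timeDeriv_sq _ ht]
    ring
  S_bot t ht := (hdecay.tendsto_timeDeriv ht).mono_left atBot_le_cocompact
  S_top t ht := (hdecay.tendsto_timeDeriv ht).mono_left atTop_le_cocompact
  C_bot t ht := by
    have hi := integrable_timeDeriv_sq hreg hdecay ht
    have h0 : Tendsto (fun x => ∫ y in Iic x, timeDeriv (fun z s => r z s ^ 2) y t) atBot (𝓝 0) :=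
      tendsto_integral_Iic_zero tendsto_id
    have hsplit : ∀ x, ∫ y in Ioi x, timeDeriv (fun z s => r z s ^ 2) y t =
        (∫ y, timeDeriv (fun z s => r z s ^ 2) y t) -
          ∫ y in Iic x, timeDeriv (fun z s => r z s ^ 2) y t := fun x => by
      rw [← intervalIntegral.integral_Iic_add_Ioi (b := x) hi.integrableOn hi.integrableOn]
      ring
    simp only [hsplit]
    have := ((h0.const_sub (∫ y, timeDeriv (fun z s => r z s ^ 2) y t)).const_mul σ).const_add
      (1 / 2)
    rwa [sub_zero] at this
  C_top t ht := by
    have h0 : Tendsto (fun x => ∫ y in Ioi x, timeDeriv (fun z s => r z s ^ 2) y t) atTop (𝓝 0) :=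
      tendsto_integral_Ioi_zero tendsto_id
    have := (h0.const_mul σ).const_add (1 / 2)
    rwa [mul_zero, add_zero] at this

theorem continuousOn_integral_timeDeriv_sq (hreg : IsRegular r) (hdecay : Decays r) :
    ContinuousOn (fun t => ∫ y, timeDeriv (fun z s => r z s ^ 2) y t) (Ici 0) := by
  intro t ht
  obtain ⟨R, hR⟩ := exists_bound_of_decays hreg hdecay (t + 1)
  obtain ⟨g, hg, -, hb⟩ := hdecay (t + 1)
  have hev : ∀ᶠ s in 𝓝[Ici 0] t, s ∈ Icc 0 (t + 1) := by
    filter_upwards [self_mem_nhdsWithin,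
      mem_nhdsWithin_of_mem_nhds (Iio_mem_nhds (lt_add_one t))] with s h0 h1
    exact ⟨h0, h1.le⟩
  refine continuousWithinAt_of_dominated (bound := fun y => 2 * R * g y)
    (hev.mono fun s hs => (integrable_timeDeriv_sq hreg hdecay hs.1).aestronglyMeasurable)
    (hev.mono fun s hs => Eventually.of_forall fun y => ?_) (hg.const_mul _)
    (Eventually.of_forall fun y => ?_)
  · rw [hreg.timeDeriv_sq _ hs.1, Real.norm_eq_abs, abs_mul, abs_mul, abs_two]
    have h1 := hR y s hs.1 hs.2
    have h2 := (hb y s hs.1 hs.2).2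
    exact mul_le_mul (by linarith) h2 (abs_nonneg _)
      (by linarith [(abs_nonneg _).trans h1])
  · have hm : MapsTo (fun s : ℝ => (y, s)) (Ici 0) (univ ×ˢ Ici 0) := fun s hs => ⟨mem_univ _, hs⟩
    have h1 := hreg.cont.comp (f := fun s : ℝ => (y, s)) (by fun_prop) hm
    have h2 := hreg.cont_timeDeriv.comp (f := fun s : ℝ => (y, s)) (by fun_prop) hm
    refine ((continuousOn_const (c := (2 : ℝ))).mul h1 |>.mul h2).congr (fun s hs => ?_) t ht
    exact hreg.timeDeriv_sq y hs

end Setup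

/-! ### The limits of C and the evolution of a. -/

namespace IsFlow

variable {σ : ℝ} {r S C : ℝ → ℝ → ℝ} {Cm Cp : ℝ → ℝ} {t : ℝ} {μ : ℂ}

/-- This is -det M, constant because M_x is a commutator with M. -/
theorem sq_add_sq_eq (h : IsFlow σ r S C Cm Cp) (ht : 0 ≤ t) (x : ℝ) :
    C x t ^ 2 + σ * S x t ^ 2 = Cp t ^ 2 := by
  have hd : ∀ x, HasDerivAt (fun x => C x t ^ 2 + σ * S x t ^ 2) 0 x := fun x =>
    (((h.deriv_C x t ht).pow 2).add (((h.deriv_S x t ht).pow 2).const_mul σ)).congr_deriv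
      (by simp; ring)
  have hl : Tendsto (fun x => C x t ^ 2 + σ * S x t ^ 2) atTop (𝓝 (Cp t ^ 2)) := by
    simpa using ((h.C_top t ht).pow 2).add (((h.S_top t ht).pow 2).const_mul σ)
  refine tendsto_nhds_unique (tendsto_const_nhds.congr fun y => ?_) hl
  exact is_const_of_deriv_eq_zero (fun x => (hd x).differentiableAt) (fun x => (hd x).deriv) x y

theorem sq_eq_sq (h : IsFlow σ r S C Cm Cp) (ht : 0 ≤ t) : Cm t ^ 2 = Cp t ^ 2 := by
  have hl : Tendsto (fun x => C x t ^ 2 + σ * S x t ^ 2) atBot (𝓝 (Cm t ^ 2)) := by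
    simpa using ((h.C_bot t ht).pow 2).add (((h.S_bot t ht).pow 2).const_mul σ)
  exact tendsto_nhds_unique hl (tendsto_const_nhds.congr fun x => (h.sq_add_sq_eq ht x).symm)

/-- For σ = -1 the invariant gives C² = Cp² + S² > 0, so C keeps the sign it has near +∞. -/
theorem eq_of_symmetric (h : IsFlow (-1) r S C Cm Cp) (ht : 0 ≤ t) (hp : 0 < Cp t) :
    Cm t = Cp t := by
  have hne : ∀ x, C x t ≠ 0 := fun x hx => by
    have := h.sq_add_sq_eq ht x
    rw [hx] at this
    nlinarith [sq_nonneg (S x t)]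
  obtain ⟨x₀, hx₀⟩ := ((h.C_top t ht).eventually_const_lt hp).exists
  have hpos : ∀ x, 0 < C x t := by
    intro x
    by_contra! hx
    obtain ⟨y, hy⟩ := mem_range_of_exists_le_of_exists_ge (h.cont_C ht) ⟨x, hx⟩ ⟨x₀, hx₀.le⟩
    exact hne y hy
  have h0 : 0 ≤ Cm t := ge_of_tendsto' (h.C_bot t ht) fun x => (hpos x).le
  exact (pow_left_inj₀ h0 hp.le two_ne_zero).1 (h.sq_eq_sq ht)

/-- Evolution of `a` for `μ ≠ 0`. -/
theorem coeffA_hasDerivWithinAt (h : IsFlow σ r S C Cm Cp) (hσ : σ = 1 ∨ σ = -1)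
    (hμ : 0 ≤ μ.im) (hμ0 : μ ≠ 0) (ht : 0 ≤ t) :
    HasDerivWithinAt (fun s => coeffA σ (fun x => r x s) μ)
      (Complex.I / (2 * μ) * (Cp t - Cm t) * coeffA σ (fun x => r x t) μ) (Ici 0) t := by
  obtain ⟨hp1, hp2⟩ := h.phi_hasDerivWithinAt hσ hμ hμ0 ht
  obtain ⟨hq1, hq2⟩ := h.psi_hasDerivWithinAt hσ hμ hμ0 ht
  refine ((hp1.mul hq2).sub (hp2.mul hq1)).congr_deriv ?_
  simp only [coeffA, wronskian]
  ring

/-- Conservation of `a` at `μ = 0`. -/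
theorem coeffA_zero_hasDerivWithinAt (h : IsFlow σ r S C Cm Cp) (hσ : σ = 1 ∨ σ = -1)
    (ht : 0 ≤ t) (hC : Cm t = Cp t) (hp : Cp t ≠ 0) :
    HasDerivWithinAt (fun s => coeffA σ (fun x => r x s) 0) 0 (Ici 0) t := by
  obtain ⟨hp1, hp2⟩ := h.phi_zero_hasDerivWithinAt hσ ht
  obtain ⟨l, hq1, hq2⟩ := h.psi_zero_hasDerivWithinAt hσ ht
  obtain ⟨he1, he2⟩ := h.phi_zero_eigenvector hσ ht
  obtain ⟨hf1, hf2⟩ := h.psi_zero_eigenvector hσ ht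
  rw [hC] at he1 he2
  have hp' : (Cp t : ℂ) ≠ 0 := Complex.ofReal_ne_zero.2 hp
  set a := (phi σ (fun x => r x t) 0 0).1
  set b := (phi σ (fun x => r x t) 0 0).2
  set c := (psi σ (fun x => r x t) 0 0).1
  set d := (psi σ (fun x => r x t) 0 0).2
  -- M is symmetric for the form x₁y₁ + σx₂y₂, and Φ, Ψ are eigenvectors for the distinct
  -- eigenvalues Cp and -Cp.
  have horth : a * c + σ * (b * d) = 0 := by
    have : (2 * Cp t : ℂ) * (a * c + σ * (b * d)) = 0 := by
      linear_combination -c * he1 - σ * d * he2 + a * hf1 + σ * b * hf2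
    exact (mul_eq_zero.1 this).resolve_left (mul_ne_zero two_ne_zero hp')
  refine ((hp1.mul hq2).sub (hp2.mul hq1)).congr_deriv ?_
  change -(σ : ℂ) * (_ * b) * d + a * -(l * c) - (_ * a * c + b * (σ * (l * d))) = 0
  linear_combination (-((∫ y in Iic 0, S y t : ℝ) : ℂ) - l) * horth

end IsFlow

theorem eq_mul_exp_of_hasDerivWithinAt {f : ℝ → ℂ} {κ : ℂ}
    (hf : ∀ t, 0 ≤ t → HasDerivWithinAt f (κ * f t) (Ici 0) t) {t : ℝ} (ht : 0 ≤ t) :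
    f t = f 0 * Complex.exp (κ * t) := by
  have hd : ∀ s, 0 ≤ s →
      HasDerivWithinAt (fun s => f s * Complex.exp (-κ * s)) 0 (Ici 0) s := fun s hs =>
    ((hf s hs).mul (hasDerivAt_cexp_mul (-κ) s).hasDerivWithinAt).congr_deriv (by ring)
  have := (convex_Ici (0 : ℝ)).norm_image_sub_le_of_norm_hasDerivWithin_le (C := 0)
    (fun s hs => hd s hs) (fun s _ => by simp) (mem_Ici.2 le_rfl) ht
  rw [zero_mul, norm_le_zero_iff, sub_eq_zero] at this
  simp only [Complex.ofReal_zero, mul_zero, Complex.exp_zero, mul_one] at this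
  rw [← this, mul_assoc, ← Complex.exp_add]
  simp

/-! ### Bounds on a in the anti-symmetric case. -/

section Antisymmetric

variable {r : ℝ → ℝ} {μ : ℂ}

/-- For σ = 1 the coupling is skew and Im μ ≥ 0 damps, so |v₁|² + |v₂|² decreases from its value 1
at -∞. The modulated Ψ tends to (0, 1) at +∞, so a is the limit of v₁ there. -/
theorem norm_coeffA_le_one (hμ : 0 ≤ μ.im) (hr : Continuous r) (hri : Integrable r) :
    ‖coeffA 1 r μ‖ ≤ 1 := by
  have hp := isPhi_phi (Or.inl rfl) hμ hr hri
  have hq := isPsi_psi (Or.inl rfl) hμ hr hri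
  have hv := hp.1.isModSolution
  set v₁ : ℝ → ℂ := fun x => Complex.exp (Complex.I * μ * x) * (phi 1 r μ x).1
  set v₂ : ℝ → ℂ := fun x => Complex.exp (Complex.I * μ * x) * (phi 1 r μ x).2
  set q₁ : ℝ → ℂ := fun x => Complex.exp (-Complex.I * μ * x) * (psi 1 r μ x).1
  set q₂ : ℝ → ℂ := fun x => Complex.exp (-Complex.I * μ * x) * (psi 1 r μ x).2
  have hanti : Antitone fun x => ‖v₁ x‖ ^ 2 + ‖v₂ x‖ ^ 2 := by
    refine antitone_of_hasDerivAt_nonpos (fun x => (hv x).1.norm_sq.add (hv x).2.norm_sq)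
      fun x => ?_
    have : 0 ≤ μ.im * ((v₂ x).re ^ 2 + (v₂ x).im ^ 2) := mul_nonneg hμ (by positivity)
    simp only [Complex.inner, Complex.mul_re, Complex.mul_im, Complex.add_re, Complex.add_im,
      Complex.conj_re, Complex.conj_im, Complex.neg_re, Complex.neg_im, Complex.ofReal_re,
      Complex.ofReal_im, Complex.I_re, Complex.I_im, Complex.zero_re, Complex.zero_im,
      Complex.re_ofNat, Complex.im_ofNat, Pi.zero_apply]
    nlinarith
  have hl₁ : Tendsto v₁ atBot (𝓝 1) := hp.tendsto_fst
  have hl₂ : Tendsto v₂ atBot (𝓝 0) := hp.tendsto_snd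
  have hle : ∀ x, ‖v₁ x‖ ^ 2 + ‖v₂ x‖ ^ 2 ≤ 1 :=
    le_of_antitone_of_tendsto hanti (by simpa using (hl₁.norm.pow 2).add (hl₂.norm.pow 2))
  have hw : ∀ x, coeffA 1 r μ = v₁ x * q₂ x - v₂ x * q₁ x := by
    intro x
    rw [coeffA, hp.1.wronskian_eq hq.1 0 x]
    have he : Complex.exp (Complex.I * μ * x) * Complex.exp (-Complex.I * μ * x) = 1 := by
      rw [← Complex.exp_add]
      simp
    simp only [wronskian, v₁, v₂, q₁, q₂]
    linear_combination (-((phi 1 r μ x).1 * (psi 1 r μ x).2 -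
      (phi 1 r μ x).2 * (psi 1 r μ x).1)) * he
  have hq₁ : Tendsto q₁ atTop (𝓝 0) := (continuous_fst.tendsto _).comp hq.2
  have hq₂ : Tendsto q₂ atTop (𝓝 1) := (continuous_snd.tendsto _).comp hq.2
  have hlim : Tendsto (fun x => ‖q₂ x‖ + ‖q₁ x‖) atTop (𝓝 1) := by
    simpa using hq₂.norm.add hq₁.norm
  refine ge_of_tendsto' hlim fun x => ?_
  rw [hw x]
  refine (norm_sub_le _ _).trans ?_
  have h1 : ‖v₁ x‖ ≤ 1 := by nlinarith [hle x, sq_nonneg ‖v₂ x‖, norm_nonneg (v₁ x)]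
  have h2 : ‖v₂ x‖ ≤ 1 := by nlinarith [hle x, sq_nonneg ‖v₁ x‖, norm_nonneg (v₂ x)]
  exact add_le_add ((norm_mul _ _).trans_le (mul_le_of_le_one_left (norm_nonneg _) h1))
    ((norm_mul _ _).trans_le (mul_le_of_le_one_left (norm_nonneg _) h2))

theorem tendsto_exp_mul_atBot_zero {c : ℂ} (hc : 0 < c.re) :
    Tendsto (fun x : ℝ => Complex.exp (c * x)) atBot (𝓝 0) := by
  rw [tendsto_zero_iff_norm_tendsto_zero]
  simp only [Complex.norm_exp, Complex.mul_re, Complex.ofReal_re, Complex.ofReal_im, mul_zero,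
    sub_zero]
  exact Real.tendsto_exp_atBot.comp (tendsto_id.const_mul_atBot hc)

theorem IsPhi.tendsto_zero {σ : ℝ} {u : ℝ → ℂ × ℂ} (h : IsPhi σ r μ u) (hμ : 0 < μ.im) :
    Tendsto u atBot (𝓝 0) := by
  have h1 := (tendsto_exp_mul_atBot_zero (c := -(Complex.I * μ)) (by simpa using hμ)).smul h.2
  rw [zero_smul] at h1
  refine h1.congr fun x => ?_
  rw [smul_smul, ← Complex.exp_add]
  simp

/-- In the anti-symmetric case the eigenvalues lie in `Im μ ≤ sup |r|`. -/
theorem coeffA_ne_zero_of_lt_im (hr : Continuous r) (hri : Integrable r) {R : ℝ}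
    (hR : ∀ x, |r x| ≤ R) (hμ : R < μ.im) : coeffA 1 r μ ≠ 0 := by
  intro ha
  have hσ : (1 : ℝ) = 1 ∨ (1 : ℝ) = -1 := Or.inl rfl
  have hμ0 : 0 < μ.im := ((abs_nonneg _).trans (hR 0)).trans_lt hμ
  have hp := isPhi_phi hσ hμ0.le hr hri
  have hq := isPsi_psi hσ hμ0.le hr hri
  obtain ⟨c, hc⟩ := hp.1.exists_eq_smul hσ hR hq.1 (hq.ne_zero hσ hR 0) ha
  set u := phi 1 r μ
  have hbot : Tendsto u atBot (𝓝 0) := hp.tendsto_zero hμ0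
  have htop : Tendsto u atTop (𝓝 0) := by
    have h1 : Tendsto (fun x => psi 1 r μ x) atTop (𝓝 0) := by
      have h2 := (continuous_swap.tendsto _).comp
        (((hq.reflect hσ).tendsto_zero hμ0).comp tendsto_neg_atTop_atBot)
      simpa [Function.comp_def] using h2
    have h3 := h1.const_smul c
    rw [smul_zero] at h3
    exact h3.congr fun x => (hc x).symm
  -- A zero of a would make u decay at both ends. But E' ≥ 2(Im μ - R)|u|², so E is monotone with
  -- limit 0 at both ends; thus E' = 0 and u = 0.
  set E : ℝ → ℝ := fun x => ‖(u x).1‖ ^ 2 - ‖(u x).2‖ ^ 2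
  have hE : ∀ x, HasDerivAt E _ x := fun x => (hp.1 x).1.norm_sq.sub (hp.1 x).2.norm_sq
  have hlow : ∀ x, 2 * (μ.im - R) * (‖(u x).1‖ ^ 2 + ‖(u x).2‖ ^ 2) ≤
      2 * inner ℝ (u x).1 (-Complex.I * μ * (u x).1 - ((1 : ℝ) : ℂ) * (r x : ℂ) * (u x).2) -
      2 * inner ℝ (u x).2 ((r x : ℂ) * (u x).1 + Complex.I * μ * (u x).2) := by
    intro x
    rw [Complex.sq_norm, Complex.sq_norm, Complex.normSq_apply, Complex.normSq_apply]
    simp only [Complex.inner, Complex.mul_re, Complex.mul_im, Complex.add_re, Complex.add_im,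
      Complex.sub_re, Complex.sub_im,
      Complex.conj_re, Complex.conj_im, Complex.neg_re, Complex.neg_im, Complex.ofReal_re,
      Complex.ofReal_im, Complex.I_re, Complex.I_im]
    obtain ⟨h1, h2⟩ := abs_le.1 (hR x)
    generalize (u x).1.re = a, (u x).1.im = b, (u x).2.re = d, (u x).2.im = e
    nlinarith [mul_nonneg (sub_nonneg.2 h2) (sq_nonneg (a + d)),
      mul_nonneg (sub_nonneg.2 h2) (sq_nonneg (b + e)),
      mul_nonneg (neg_le_iff_add_nonneg.1 h1) (sq_nonneg (a - d)),
      mul_nonneg (neg_le_iff_add_nonneg.1 h1) (sq_nonneg (b - e))]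
  have hmono : Monotone E := monotone_of_hasDerivAt_nonneg hE fun x =>
    le_trans (mul_nonneg (by linarith) (by positivity)) (hlow x)
  have hElim : ∀ {l : Filter ℝ}, Tendsto u l (𝓝 0) → Tendsto E l (𝓝 0) := fun hl => by
    simpa using (((continuous_fst.tendsto _).comp hl).norm.pow 2).sub
      (((continuous_snd.tendsto _).comp hl).norm.pow 2)
  have hE0 : E = fun _ => 0 := funext fun x =>
    le_antisymm (hmono.ge_of_tendsto (hElim htop) x) (hmono.le_of_tendsto (hElim hbot) x)
  have hu : ∀ x, (u x).1 = 0 := by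
    intro x
    have h1 := (hE x).unique (hE0 ▸ hasDerivAt_const x (0 : ℝ))
    have h2 := hlow x
    rw [h1] at h2
    have h3 : 0 < 2 * (μ.im - R) := by linarith
    have h4 := nonpos_of_mul_nonpos_right h2 h3
    have h5 : ‖(u x).1‖ ^ 2 = 0 :=
      le_antisymm (by nlinarith [sq_nonneg ‖(u x).2‖]) (sq_nonneg _)
    simpa using h5
  have hl := hp.tendsto_fst
  change Tendsto (fun x : ℝ => Complex.exp (Complex.I * μ * x) * (u x).1) atBot (𝓝 1) at hl
  simp only [hu, mul_zero] at hl
  exact zero_ne_one (tendsto_nhds_unique tendsto_const_nhds hl)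

end Antisymmetric

end ZS

namespace ZS

open scoped ComplexConjugate

/-! ### The coefficient b, the normalization constants and their evolution. -/

section Coefficients

variable {σ : ℝ} {r : ℝ → ℝ} {μ : ℂ} {m : ℝ}

theorem wronskian_psiBar_psi (hσ : σ = 1 ∨ σ = -1) (hr : Continuous r) (hri : Integrable r)
    (x : ℝ) : wronskian (psiBar σ r m) (psi σ r m) x = 1 := by
  have hb := isPsiBar_psiBar (m := m) hσ hr hri
  have hq := isPsi_psi (μ := m) hσ (by simp) hr hri
  have h1 := ((continuous_fst.tendsto _).comp hb.2).mul ((continuous_snd.tendsto _).comp hq.2)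
  have h2 := ((continuous_snd.tendsto _).comp hb.2).mul ((continuous_fst.tendsto _).comp hq.2)
  have h3 := h1.sub h2
  simp only [mul_zero, mul_one, sub_zero] at h3
  refine tendsto_nhds_unique (tendsto_const_nhds.congr fun y => ?_) h3
  have he : Complex.exp (Complex.I * m * y) * Complex.exp (-Complex.I * m * y) = 1 := by
    rw [← Complex.exp_add]
    simp
  rw [hb.1.wronskian_eq hq.1 x y]
  simp only [wronskian, Function.comp_apply, Prod.smul_fst, Prod.smul_snd, smul_eq_mul]
  linear_combination (-((psiBar σ r m y).1 * (psi σ r m y).2 -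
      (psiBar σ r m y).2 * (psi σ r m y).1)) * he

/-- Cramer's rule in the basis Ψ̄, Ψ, whose Wronskian is 1. It replaces the choice in the definition
of b by an expression that can be differentiated. -/
theorem coeffB_eq (hσ : σ = 1 ∨ σ = -1) (hr : Continuous r) (hri : Integrable r) :
    coeffB σ r m = wronskian (psiBar σ r m) (phi σ r m) 0 := by
  have hm : 0 ≤ (m : ℂ).im := by simp
  have hb := isPsiBar_psiBar (m := m) hσ hr hri
  have hq := isPsi_psi (μ := m) hσ hm hr hri
  have hp := isPhi_phi (μ := m) hσ hm hr hri
  have hex : ∀ x, phi σ r m x = coeffA σ r m • psiBar σ r m x +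
      wronskian (psiBar σ r m) (phi σ r m) 0 • psi σ r m x := by
    intro x
    have h1 := wronskian_psiBar_psi (m := m) hσ hr hri x
    rw [coeffA, hp.1.wronskian_eq hq.1 0 x, hb.1.wronskian_eq hp.1 0 x]
    simp only [wronskian] at h1 ⊢
    ext1
    · simp only [Prod.fst_add, Prod.smul_fst, smul_eq_mul]
      linear_combination (-(phi σ r m x).1) * h1
    · simp only [Prod.snd_add, Prod.smul_snd, smul_eq_mul]
      linear_combination (-(phi σ r m x).2) * h1
  have hs : ∀ x, phi σ r m x = coeffA σ r m • psiBar σ r m x + coeffB σ r m • psi σ r m x :=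
    Classical.epsilon_spec (p := fun b : ℂ =>
      ∀ x : ℝ, phi σ r m x = coeffA σ r m • psiBar σ r m x + b • psi σ r m x) ⟨_, hex⟩
  have h0 := (hs 0).symm.trans (hex 0)
  have hne : psi σ r m 0 ≠ 0 := by
    intro h
    have h1 := wronskian_psiBar_psi (m := m) hσ hr hri 0
    simp [wronskian, h] at h1
  exact smul_left_injective ℂ hne (add_left_cancel h0)

theorem normConst_spec {R : ℝ} (hσ : σ = 1 ∨ σ = -1) (hμ : 0 ≤ μ.im) (hr : Continuous r)
    (hri : Integrable r) (hR : ∀ x, |r x| ≤ R) (ha : coeffA σ r μ = 0) (x : ℝ) :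
    phi σ r μ x = normConst σ r μ • psi σ r μ x := by
  have hp := isPhi_phi hσ hμ hr hri
  have hq := isPsi_psi hσ hμ hr hri
  exact Classical.epsilon_spec (p := fun c : ℂ => ∀ x : ℝ, phi σ r μ x = c • psi σ r μ x)
    (hp.1.exists_eq_smul hσ hR hq.1 (hq.ne_zero hσ hR 0) ha) x

end Coefficients

/-- If `p = c q` with `q ≠ 0` and `p' = c q' + κ c q`, then `c' = κ c`. -/
theorem hasDerivWithinAt_of_eq_mul {s : Set ℝ} {t : ℝ} (ht : t ∈ s) {c p₁ p₂ q₁ q₂ : ℝ → ℂ}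
    {p₁' p₂' q₁' q₂' κ : ℂ} (h₁ : ∀ τ ∈ s, p₁ τ = c τ * q₁ τ) (h₂ : ∀ τ ∈ s, p₂ τ = c τ * q₂ τ)
    (hq : ∀ τ ∈ s, ¬(q₁ τ = 0 ∧ q₂ τ = 0)) (hp₁ : HasDerivWithinAt p₁ p₁' s t)
    (hp₂ : HasDerivWithinAt p₂ p₂' s t) (hq₁ : HasDerivWithinAt q₁ q₁' s t)
    (hq₂ : HasDerivWithinAt q₂ q₂' s t) (he₁ : p₁' = c t * q₁' + κ * c t * q₁ t)
    (he₂ : p₂' = c t * q₂' + κ * c t * q₂ t) : HasDerivWithinAt c (κ * c t) s t := by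
  -- Either component of q may vanish at some times, so c is written as (p₁q̄₁ + p₂q̄₂)/(|q₁|² +
  -- |q₂|²).
  have hD : ∀ τ ∈ s, q₁ τ * conj (q₁ τ) + q₂ τ * conj (q₂ τ) ≠ 0 := by
    intro τ hτ h0
    rw [Complex.mul_conj, Complex.mul_conj, ← Complex.ofReal_add, Complex.ofReal_eq_zero] at h0
    have h1 := Complex.normSq_nonneg (q₁ τ)
    have h2 := Complex.normSq_nonneg (q₂ τ)
    exact hq τ hτ ⟨Complex.normSq_eq_zero.1 (by linarith), Complex.normSq_eq_zero.1 (by linarith)⟩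
  have hc₁ : HasDerivWithinAt (fun τ => conj (q₁ τ)) (conj q₁') s t := hq₁.star
  have hc₂ : HasDerivWithinAt (fun τ => conj (q₂ τ)) (conj q₂') s t := hq₂.star
  have hd := ((hp₁.mul hc₁).add (hp₂.mul hc₂)).div ((hq₁.mul hc₁).add (hq₂.mul hc₂)) (hD t ht)
  refine (hd.congr_of_mem (fun τ hτ => ?_) ht).congr_deriv ?_
  · simp only [Pi.div_apply, Pi.add_apply, Pi.mul_apply]
    rw [eq_div_iff (hD τ hτ), h₁ τ hτ, h₂ τ hτ]
    ring
  · simp only [Pi.add_apply, Pi.mul_apply]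
    rw [div_eq_iff (pow_ne_zero 2 (hD t ht)), h₁ t ht, h₂ t ht, he₁, he₂]
    ring

namespace IsFlow

variable {σ : ℝ} {r S C : ℝ → ℝ → ℝ} {Cm Cp : ℝ → ℝ} {t : ℝ} {μ : ℂ}

/-- Evolution of `b`. -/
theorem coeffB_hasDerivWithinAt {m : ℝ} (h : IsFlow σ r S C Cm Cp) (hσ : σ = 1 ∨ σ = -1)
    (hm : m ≠ 0) (ht : 0 ≤ t) :
    HasDerivWithinAt (fun s => coeffB σ (fun x => r x s) m)
      (-(Complex.I / (2 * m) * (Cp t + Cm t)) * coeffB σ (fun x => r x t) m) (Ici 0) t := by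
  have hμ : 0 ≤ (m : ℂ).im := by simp
  obtain ⟨hp1, hp2⟩ := h.phi_hasDerivWithinAt hσ hμ (Complex.ofReal_ne_zero.2 hm) ht
  obtain ⟨hq1, hq2⟩ := h.psi_hasDerivWithinAt hσ hμ (Complex.ofReal_ne_zero.2 hm) ht
  -- Ψ̄ is expressed by the conjugate of Ψ; for real m, conjugation reverses the sign of i/(2m),
  -- which is why Cp + Cm appears for b and Cp - Cm for a.
  have hq1' : HasDerivWithinAt (fun s => conj (psi σ (fun x => r x s) m 0).1) _ (Ici 0) t := hq1.star
  have hq2' : HasDerivWithinAt (fun s => conj (psi σ (fun x => r x s) m 0).2) _ (Ici 0) t := hq2.star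
  have hb : ∀ s, 0 ≤ s → coeffB σ (fun x => r x s) m =
      conj (psi σ (fun x => r x s) m 0).2 * (phi σ (fun x => r x s) m 0).2 -
        -σ * conj (psi σ (fun x => r x s) m 0).1 * (phi σ (fun x => r x s) m 0).1 := fun s hs => by
    rw [coeffB_eq hσ (h.cont s hs) (h.integrable hs), wronskian,
      psiBar_eq hσ (h.cont s hs) (h.integrable hs)]
  refine ((((hq2'.mul hp2).sub ((hq1'.const_mul (-σ : ℂ)).mul hp1))).congr_of_mem
    (fun s hs => hb s hs) ht).congr_deriv ?_
  rw [hb t ht]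
  have hσσ := sign_mul_self hσ
  simp only [Complex.star_def, map_mul, map_add, map_sub, map_div₀, Complex.conj_I,
    Complex.conj_ofReal, Complex.conj_ofNat]
  linear_combination (-(Complex.I / (2 * m)) * S 0 t * conj (psi σ (fun x => r x t) m 0).2 *
    (phi σ (fun x => r x t) m 0).1 + Complex.I / (2 * m) * S 0 t *
    conj (psi σ (fun x => r x t) m 0).1 * (phi σ (fun x => r x t) m 0).2) * hσσ

/-- Evolution of the normalization constants. -/
theorem normConst_hasDerivWithinAt (h : IsFlow σ r S C Cm Cp) (hσ : σ = 1 ∨ σ = -1)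
    (hR : ∀ s, 0 ≤ s → ∃ R, ∀ x, |r x s| ≤ R) (hμ : 0 ≤ μ.im) (hμ0 : μ ≠ 0)
    (ha : ∀ s, 0 ≤ s → coeffA σ (fun x => r x s) μ = 0) (ht : 0 ≤ t) :
    HasDerivWithinAt (fun s => normConst σ (fun x => r x s) μ)
      (-(Complex.I / (2 * μ) * (Cp t + Cm t)) * normConst σ (fun x => r x t) μ) (Ici 0) t := by
  obtain ⟨hp1, hp2⟩ := h.phi_hasDerivWithinAt hσ hμ hμ0 ht
  obtain ⟨hq1, hq2⟩ := h.psi_hasDerivWithinAt hσ hμ hμ0 ht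
  have hspec : ∀ s, 0 ≤ s → phi σ (fun x => r x s) μ 0 =
      normConst σ (fun x => r x s) μ • psi σ (fun x => r x s) μ 0 := fun s hs => by
    obtain ⟨R, hRs⟩ := hR s hs
    exact normConst_spec hσ hμ (h.cont s hs) (h.integrable hs) hRs (ha s hs) 0
  refine hasDerivWithinAt_of_eq_mul (mem_Ici.2 ht) (fun s hs => congrArg Prod.fst (hspec s hs))
    (fun s hs => congrArg Prod.snd (hspec s hs)) (fun s hs hz => ?_) hp1 hp2 hq1 hq2 ?_ ?_
  · obtain ⟨R, hRs⟩ := hR s hs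
    exact (h.isPsi hσ hμ hs).ne_zero hσ hRs 0 (Prod.ext hz.1 hz.2)
  · rw [hspec t ht]
    simp only [Prod.smul_fst, Prod.smul_snd, smul_eq_mul]
    ring
  · rw [hspec t ht]
    simp only [Prod.smul_fst, Prod.smul_snd, smul_eq_mul]
    ring

/-- In the anti-symmetric case the limits of `C` at `±∞` cannot be `∓1/2` for all times. -/
theorem not_forall_eq_neg (h : IsFlow 1 r S C Cm Cp) {R : ℝ} (hR : ∀ x, |r x 0| ≤ R)
    (hp : ∀ t, 0 ≤ t → Cp t = 1 / 2) : ¬∀ t, 0 ≤ t → Cm t = -(1 / 2) := by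
  intro hm
  have hσ : (1 : ℝ) = 1 ∨ (1 : ℝ) = -1 := Or.inl rfl
  have hR0 : 0 ≤ R := (abs_nonneg _).trans (hR 0)
  -- For μ = iη the rate i/(2μ) = 1/(2η) is positive, and η > R excludes a zero of a at time 0.
  set η : ℝ := R + 1
  have hη : 0 < η := by positivity
  set μ : ℂ := η * Complex.I
  have him : μ.im = η := by simp [μ]
  have hμ : 0 ≤ μ.im := by rw [him]; exact hη.le
  have hμ0 : μ ≠ 0 := mul_ne_zero (Complex.ofReal_ne_zero.2 hη.ne') Complex.I_ne_zero
  have ha0 : coeffA 1 (fun x => r x 0) μ ≠ 0 :=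
    coeffA_ne_zero_of_lt_im (h.cont 0 le_rfl) (h.integrable le_rfl) hR (by rw [him]; linarith)
  have hκ : Complex.I / (2 * μ) = ((1 / (2 * η) : ℝ) : ℂ) := by
    have hη' : (η : ℂ) ≠ 0 := Complex.ofReal_ne_zero.2 hη.ne'
    have hI := Complex.I_ne_zero
    simp only [μ]
    push_cast
    field_simp
  have hev : ∀ t, 0 ≤ t → coeffA 1 (fun x => r x t) μ =
      coeffA 1 (fun x => r x 0) μ * Complex.exp (((1 / (2 * η) : ℝ) : ℂ) * t) := fun t ht =>
    eq_mul_exp_of_hasDerivWithinAt (fun s hs =>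
      (h.coeffA_hasDerivWithinAt hσ hμ hμ0 hs).congr_deriv (by
        rw [hp s hs, hm s hs, hκ]
        push_cast
        ring)) ht
  have hpos := norm_pos_iff.2 ha0
  set α := ‖coeffA 1 (fun x => r x 0) μ‖
  -- At this time |a| = α e^{1/α} ≥ α + 1 > 1.
  have ht : 0 ≤ 2 * η / α := by positivity
  have h1 := norm_coeffA_le_one hμ (h.cont _ ht) (h.integrable ht)
  rw [hev _ ht, norm_mul, ← Complex.ofReal_mul, Complex.norm_exp, Complex.ofReal_re] at h1
  have h2 : 1 / (2 * η) * (2 * η / α) = 1 / α := by field_simp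
  rw [h2] at h1
  have h3 := mul_le_mul_of_nonneg_left (Real.add_one_le_exp (1 / α)) hpos.le
  have h4 : α * (1 / α + 1) = 1 + α := by field_simp
  linarith

end IsFlow

/-- Under the evolution equation `∫ (r²)_t dy = 0`, so that `1/2 + σ ∫_x^∞ (r²)_t` has the same limit
at both ends. -/
theorem half_add_integral_eq {σ : ℝ} {r : ℝ → ℝ → ℝ} (hσ : σ = 1 ∨ σ = -1) (hreg : IsRegular r)
    (hdecay : Decays r) (heq : SolvesEquation σ r) {t : ℝ} (ht : 0 ≤ t) :
    1 / 2 + σ * ∫ y, timeDeriv (fun z s => r z s ^ 2) y t = 1 / 2 := by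
  have h := isFlow hreg hdecay heq
  rcases hσ with rfl | rfl
  · have hc : ContinuousOn
        (fun t => 1 / 2 + 1 * ∫ y, timeDeriv (fun z s => r z s ^ 2) y t) (Ici 0) :=
      continuousOn_const.add (continuousOn_const.mul
        (continuousOn_integral_timeDeriv_sq hreg hdecay))
    obtain ⟨R, hR⟩ := exists_bound_of_decays hreg hdecay 0
    -- A continuous function of t ≥ 0 with square 1/4 is constant.
    rcases isPreconnected_Ici.eq_or_eq_neg_of_sq_eq hc
      (continuousOn_const (c := (1 / 2 : ℝ))) (fun s hs => h.sq_eq_sq hs)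
      (fun _ => by norm_num) with h1 | h1
    · exact h1 ht
    · exact absurd (fun s hs => h1 hs)
        (h.not_forall_eq_neg (fun x => hR x 0 le_rfl le_rfl) fun _ _ => rfl)
  · exact h.eq_of_symmetric ht one_half_pos

end ZS

/-! ### Integration of the linear evolution laws. -/

theorem theorem1 (σ : ℝ) (hσ : σ = 1 ∨ σ = -1) (r : ℝ → ℝ → ℝ)
    (hreg : ZS.IsRegular r) (hdecay : ZS.Decays r) (heq : ZS.SolvesEquation σ r) :
    ∀ t : ℝ, 0 ≤ t →
      (∀ μ : ℂ, 0 ≤ μ.im →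
        ZS.coeffA σ (fun x => r x t) μ = ZS.coeffA σ (fun x => r x 0) μ) ∧
      (∀ μ : ℝ, μ ≠ 0 →
        ZS.coeffB σ (fun x => r x t) μ =
          ZS.coeffB σ (fun x => r x 0) μ * Complex.exp (-(Complex.I / (2 * (μ : ℂ))) * (t : ℂ))) ∧
      ZS.eigenvalues σ (fun x => r x t) = ZS.eigenvalues σ (fun x => r x 0) ∧
      (∀ μ ∈ ZS.eigenvalues σ (fun x => r x 0),
        ZS.normConst σ (fun x => r x t) μ =
          ZS.normConst σ (fun x => r x 0) μ *
            Complex.exp (-(Complex.I / (2 * μ)) * (t : ℂ))) := by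
  have h := ZS.isFlow hreg hdecay heq
  have hhalf : ∀ s, 0 ≤ s →
      1 / 2 + σ * ∫ y, ZS.timeDeriv (fun z s => r z s ^ 2) y s = 1 / 2 :=
    fun s hs => ZS.half_add_integral_eq hσ hreg hdecay heq hs
  have hsum : ((1 / 2 : ℝ) : ℂ) + ((1 / 2 : ℝ) : ℂ) = 1 := by norm_num
  have hA : ∀ t : ℝ, 0 ≤ t → ∀ μ : ℂ, 0 ≤ μ.im →
      ZS.coeffA σ (fun x => r x t) μ = ZS.coeffA σ (fun x => r x 0) μ := by
    intro t ht μ hμ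
    have hd : ∀ s, 0 ≤ s → HasDerivWithinAt (fun s => ZS.coeffA σ (fun x => r x s) μ)
        (0 * ZS.coeffA σ (fun x => r x s) μ) (Ici 0) s := by
      intro s hs
      by_cases hμ0 : μ = 0
      · subst hμ0
        exact (h.coeffA_zero_hasDerivWithinAt hσ hs (hhalf s hs) (by norm_num)).congr_deriv
          (by rw [zero_mul])
      · exact (h.coeffA_hasDerivWithinAt hσ hμ hμ0 hs).congr_deriv
          (by rw [hhalf s hs, sub_self, mul_zero])
    simpa using ZS.eq_mul_exp_of_hasDerivWithinAt hd ht
  intro t ht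
  refine ⟨hA t ht, fun μ hμ => ?_, ?_, fun μ hμ => ?_⟩
  · exact ZS.eq_mul_exp_of_hasDerivWithinAt (fun s hs =>
      (h.coeffB_hasDerivWithinAt hσ hμ hs).congr_deriv
        (by rw [hhalf s hs, hsum, mul_one])) ht
  · ext μ
    exact and_congr_right fun hμ => by rw [hA t ht μ hμ.le]
  · have hμ0 : μ ≠ 0 := by
      rintro rfl
      exact lt_irrefl _ hμ.1
    have hR : ∀ s, 0 ≤ s → ∃ R, ∀ x, |r x s| ≤ R := fun s hs => by
      obtain ⟨R, hR⟩ := ZS.exists_bound_of_decays hreg hdecay s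
      exact ⟨R, fun x => hR x s hs le_rfl⟩
    exact ZS.eq_mul_exp_of_hasDerivWithinAt (fun s hs =>
      (h.normConst_hasDerivWithinAt hσ hR hμ.1.le hμ0
        (fun s hs => (hA s hs μ hμ.1.le).trans hμ.2) hs).congr_deriv
        (by rw [hhalf s hs, hsum, mul_one])) ht
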